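/- Let $n,N\ge 0$ be integers. Let $\mathbb C^{n|n}$ have the standard basis $e_1,\dots,e_{2n}$, with parities $p_i=p(e_i)=0$ for $i\le n$ and $p_i=1$ for $i>n$, and put $\delta(i)\equiv i+n \pmod{2n}$. Let $Q(n)=\left\{\begin{pmatrix}A&B\\B&A\end{pmatrix}: A,B\in \mathrm{Mat}(n,\mathbb C)\right\}\subset\mathfrak{gl}(n,n)$, an associative superalgebra and, under the supercommutator, a Lie superalgebra; let $S(Q(n))$ and $U(Q(n))$ be its (super)symmetric algebra and its universal enveloping algebra. **Special symmetrization.** For homogeneous $Y_1,\dots,Y_k,X\in Q(n)$ set, in $S(Q(n))$, $$(Y_1\cdots Y_k)*X=Y_1\cdots Y_kX+\sum_{r=1}^k(-1)^{p(X)\sum_{s>r}p(Y_s)}\,Y_1\cdots Y_{r-1}\langle Y_rX\rangle Y_{r+1}\cdots Y_k,$$ where $\langle\cdot\,\cdot\rangle$ is the matrix product. The map $X_1\cdots X_k\mapsto((\cdots(X_1*X_2)*\cdots)*X_{k-1})*X_k$ is a well-defined linear isomorphism $\tilde\sigma:U(Q(n))\to S(Q(n))$; let $\sigma=\tilde\sigma^{-1}$.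 **The Sergeev group.** Let $\mathcal H_N$ be the group generated by $a_1,\dots,a_N,\varepsilon$ with relations $a_p^2=\varepsilon$, $\varepsilon^2=1$, $a_pa_q=\varepsilon a_qa_p$ $(p\ne q)$, and let $Se(N)=\mathcal H_N\rtimes S_N$, where $\tau(a_p)=a_{\tau(p)}$ and $\tau(\varepsilon)=\varepsilon$. **The actions.** On $(\mathbb C^{n|n})^{\otimes N}$, $U(Q(n))$ acts by the $N$-th tensor power (with the rule of signs) of the vector representation. $Se(N)$ acts as follows: $\tau\in S_N$ sends $v_1\otimes\cdots\otimes v_N$ ($v_i$ homogeneous) to $c\,v_{\tau^{-1}(1)}\otimes\cdots\otimes v_{\tau^{-1}(N)}$, where $c=\prod(-1)^{p(v_i)p(v_j)}$ over all $i<j$ with $\tau(i)>\tau(j)$; $\varepsilon$ acts by $-\mathrm{Id}$; and $a_t$ acts by the odd operator $P=\begin{pmatrix}0&1\\-1&0\end{pmatrix}$ in the $t$-th place, that is, by $v_1\otimes\cdots\otimes v_N\mapsto(-1)^{p(v_1)+\cdots+p(v_{t-1})}v_1\otimes\cdots\otimes Pv_t\otimes\cdots\otimes v_N$. **The elements.**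 Let $\rho=(\rho_1\ge\dots\ge\rho_l)$ be a partition of $k=|\rho|\le N$. Set $$q_{\rho,N}=\sum_{(i_1,\dots,i_k)}\ \sum_{\alpha}\,(a_{\alpha_1}\cdots a_{\alpha_s})\,(i_1,\dots,i_{\rho_1})\cdots(i_{\rho_1+\dots+\rho_{l-1}+1},\dots,i_k)\,(a_{\alpha_1}\cdots a_{\alpha_s})^{-1}\in\mathbb C[Se(N)],$$ summed over all sequences of pairwise distinct $i_t\in\{1,\dots,N\}$ and all subsets $\alpha=\{\alpha_1<\dots<\alpha_s\}$ of $\{i_1,\dots,i_k\}$; here $(a,\dots,z)$ is the cycle $a\to\dots\to z\to a$. Let $F_{ij}=E_{ij}+E_{\delta(i)\delta(j)}\in Q(n)$, where $E_{ij}$ are the matrix units, and set $$J_m=\sum_{i_1,\dots,i_m=1}^{2n}(-1)^{p_{i_2}+\dots+p_{i_m}}F_{i_1i_2}F_{i_2i_3}\cdots F_{i_mi_1}\in S(Q(n)),\qquad J_\rho=J_{\rho_1}\cdots J_{\rho_l}.$$ **Theorem.** The element $q_{\rho,N}$ lies in the center of $\mathbb C[Se(N)]$, and $q_{\rho,N}\in\mathbb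 C[Se(N)]$ and $\sigma(J_\rho)\in U(Q(n))$ act on $(\mathbb C^{n|n})^{\otimes N}$ by the same operator. -/

import Mathlib

open scoped TensorProduct

noncomputable section

namespace SuperDuality

/-- The Koszul sign `(-1)^{ij}`. -/
def koszul (i j : ZMod 2) : ℂ := (-1) ^ (i.val * j.val)

section Enveloping

variable {A : Type*} [Ring A] [Algebra ℂ A] (𝒜 : ZMod 2 → Submodule ℂ A)

/-- The defining relations `XY - (-1)^{p(X)p(Y)} YX = a [X, Y]`, for homogeneous `X, Y`, where
`[X, Y] = ⟨XY⟩ - (-1)^{p(X)p(Y)} ⟨YX⟩` is the supercommutator of the associative superalgebra `A`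
and `⟨XY⟩` is the product in `A`. -/
inductive EnvRel (a : ℂ) : TensorAlgebra ℂ A → TensorAlgebra ℂ A → Prop
  | swap {i j : ZMod 2} {X Y : A} (hX : X ∈ 𝒜 i) (hY : Y ∈ 𝒜 j) :
      EnvRel a
        (TensorAlgebra.ι ℂ X * TensorAlgebra.ι ℂ Y
          - koszul i j • (TensorAlgebra.ι ℂ Y * TensorAlgebra.ι ℂ X))
        (a • TensorAlgebra.ι ℂ (X * Y - koszul i j • (Y * X)))

/-- The quotient of the tensor algebra of `A` by `XY - (-1)^{p(X)p(Y)} YX = a [X, Y]`. -/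
def Env (a : ℂ) : Type _ := RingQuot (EnvRel 𝒜 a)

instance (a : ℂ) : Ring (Env 𝒜 a) := inferInstanceAs (Ring (RingQuot (EnvRel 𝒜 a)))

instance (a : ℂ) : Algebra ℂ (Env 𝒜 a) := inferInstanceAs (Algebra ℂ (RingQuot (EnvRel 𝒜 a)))

/-- The (super)symmetric algebra `S(A)` of the superspace `A`. -/
abbrev SuperSym : Type _ := Env 𝒜 0

/-- The universal enveloping algebra `U(A)` of `A`, viewed as a Lie superalgebra under the
supercommutator. -/
abbrev SuperEnv : Type _ := Env 𝒜 1

namespace Env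

/-- The quotient map. -/
def mk (a : ℂ) : TensorAlgebra ℂ A →ₐ[ℂ] Env 𝒜 a := RingQuot.mkAlgHom ℂ (EnvRel 𝒜 a)

/-- The canonical map from `A`. -/
def ι (a : ℂ) : A →ₗ[ℂ] Env 𝒜 a := (mk 𝒜 a).toLinearMap ∘ₗ TensorAlgebra.ι ℂ

variable {𝒜}

theorem ι_swap (a : ℂ) {i j : ZMod 2} {X Y : A} (hX : X ∈ 𝒜 i) (hY : Y ∈ 𝒜 j) :
    ι 𝒜 a X * ι 𝒜 a Y
      = koszul i j • (ι 𝒜 a Y * ι 𝒜 a X) + a • ι 𝒜 a (X * Y - koszul i j • (Y * X)) := by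
  have h := RingQuot.mkAlgHom_rel ℂ (EnvRel.swap (a := a) hX hY)
  rw [map_sub, map_smul, map_smul, map_mul, map_mul, sub_eq_iff_eq_add'] at h
  exact h

/-- The universal property of `Env 𝒜 a`. -/
def lift {B : Type*} [Ring B] [Algebra ℂ B] (a : ℂ) (f : A →ₗ[ℂ] B)
    (hf : ∀ (i j : ZMod 2) (X Y : A), X ∈ 𝒜 i → Y ∈ 𝒜 j →
      f X * f Y - koszul i j • (f Y * f X) = a • f (X * Y - koszul i j • (Y * X))) :
    Env 𝒜 a →ₐ[ℂ] B :=
  RingQuot.liftAlgHom ℂ ⟨TensorAlgebra.lift ℂ f, by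
    rintro _ _ ⟨hX, hY⟩
    simpa only [map_sub, map_smul, map_mul, TensorAlgebra.lift_ι_apply] using hf _ _ _ _ hX hY⟩

@[simp]
theorem lift_ι {B : Type*} [Ring B] [Algebra ℂ B] (a : ℂ) (f : A →ₗ[ℂ] B) (hf) (X : A) :
    lift (𝒜 := 𝒜) a f hf (ι 𝒜 a X) = f X := by
  have h := RingQuot.liftAlgHom_mkAlgHom_apply ℂ (TensorAlgebra.lift ℂ f)
    (s := EnvRel 𝒜 a) (by
    rintro _ _ ⟨hX, hY⟩
    simpa only [map_sub, map_smul, map_mul, TensorAlgebra.lift_ι_apply] using hf _ _ _ _ hX hY)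
    (TensorAlgebra.ι ℂ X)
  rw [TensorAlgebra.lift_ι_apply] at h
  exact h

/-- Operators `f X` on `M` which satisfy the opposite relations define a right action of
`Env 𝒜 a` on `M`; `rightAct a f hf u m` is the result `m · u` of acting by `u` on `m`. -/
def rightAct {M : Type*} [AddCommGroup M] [Module ℂ M] (a : ℂ) (f : A →ₗ[ℂ] Module.End ℂ M)
    (hf : ∀ (i j : ZMod 2) (X Y : A), X ∈ 𝒜 i → Y ∈ 𝒜 j → ∀ m,
      f Y (f X m) - koszul i j • f X (f Y m) = a • f (X * Y - koszul i j • (Y * X)) m) :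
    Env 𝒜 a →ₗ[ℂ] Module.End ℂ M :=
  (MulOpposite.opLinearEquiv ℂ).symm.toLinearMap ∘ₗ
    (lift (B := (Module.End ℂ M)ᵐᵒᵖ) a ((MulOpposite.opLinearEquiv ℂ).toLinearMap ∘ₗ f) (by
      intro i j X Y hX hY
      apply MulOpposite.unop_injective
      exact LinearMap.ext (hf i j X Y hX hY))).toLinearMap

theorem rightAct_one {M : Type*} [AddCommGroup M] [Module ℂ M] (a : ℂ)
    (f : A →ₗ[ℂ] Module.End ℂ M) (hf) (m : M) : rightAct (𝒜 := 𝒜) a f hf 1 m = m := by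
  simp [rightAct]

theorem rightAct_mul_ι {M : Type*} [AddCommGroup M] [Module ℂ M] (a : ℂ)
    (f : A →ₗ[ℂ] Module.End ℂ M) (hf) (u : Env 𝒜 a) (X : A) (m : M) :
    rightAct a f hf (u * ι 𝒜 a X) m = f X (rightAct a f hf u m) := by
  simp [rightAct]

/-- Induction by multiplication by generators on the right. -/
theorem induction_right {a : ℂ} {C : Env 𝒜 a → Prop} (one : C 1)
    (add : ∀ u v, C u → C v → C (u + v)) (smul : ∀ (c : ℂ) u, C u → C (c • u))
    (mul : ∀ u X, C u → C (u * ι 𝒜 a X)) (u : Env 𝒜 a) : C u := by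
  suffices H : ∀ (w : TensorAlgebra ℂ A) (v : Env 𝒜 a), C v → C (v * mk 𝒜 a w) by
    obtain ⟨w, rfl⟩ := RingQuot.mkAlgHom_surjective ℂ (EnvRel 𝒜 a) u
    have h := H w 1 one
    rw [one_mul] at h
    exact h
  intro w
  induction w using TensorAlgebra.induction with
  | algebraMap r =>
    intro v hv
    rw [AlgHom.commutes, ← Algebra.commutes, ← Algebra.smul_def]
    exact smul _ _ hv
  | ι X => intro v hv; exact mul v X hv
  | mul x y hx hy =>
    intro v hv
    rw [map_mul, ← mul_assoc]
    exact hy _ (hx _ hv)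
  | add x y hx hy =>
    intro v hv
    rw [map_add, mul_add]
    exact add _ _ (hx _ hv) (hy _ hv)

end Env

theorem koszul_comm (i j : ZMod 2) : koszul i j = koszul j i := by
  rw [koszul, koszul, mul_comm]

theorem zmod2_cases (i : ZMod 2) : i = 0 ∨ i = 1 := by
  revert i; decide

@[simp] theorem koszul_zero_left (j : ZMod 2) : koszul 0 j = 1 := by simp [koszul]

@[simp] theorem koszul_zero_right (j : ZMod 2) : koszul j 0 = 1 := by simp [koszul]

@[simp] theorem koszul_one_one : koszul 1 1 = -1 := by
  have : (1 : ZMod 2).val = 1 := rfl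
  simp [koszul, this]

@[simp] theorem two_zmod2 : (1 + 1 : ZMod 2) = 0 := rfl

@[simp] theorem zmod2_val_one : (1 : ZMod 2).val = 1 := rfl

theorem koszul_add_right (i j k : ZMod 2) : koszul i (j + k) = koszul i j * koszul i k := by
  rcases zmod2_cases i with rfl | rfl <;> rcases zmod2_cases j with rfl | rfl <;>
    rcases zmod2_cases k with rfl | rfl <;> simp

theorem koszul_sq (i j : ZMod 2) : koszul i j * koszul i j = 1 := by
  rw [koszul, ← mul_pow]; simp

variable [GradedAlgebra 𝒜]

theorem proj_same {i : ZMod 2} {X : A} (hX : X ∈ 𝒜 i) : GradedAlgebra.proj 𝒜 i X = X := by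
  rw [GradedAlgebra.proj_apply, DirectSum.decompose_of_mem_same _ hX]

theorem proj_ne {i j : ZMod 2} (h : i ≠ j) {X : A} (hX : X ∈ 𝒜 i) :
    GradedAlgebra.proj 𝒜 j X = 0 := by
  rw [GradedAlgebra.proj_apply, DirectSum.decompose_of_mem_ne _ hX h]

theorem proj_add (X : A) : GradedAlgebra.proj 𝒜 0 X + GradedAlgebra.proj 𝒜 1 X = X := by
  classical
  have h := DirectSum.sum_support_decompose 𝒜 X
  rw [Finset.sum_subset (Finset.subset_univ _)
    (fun i _ hi => by simpa using hi)] at h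
  exact (Fin.sum_univ_two _).symm.trans h

theorem proj_mem (i : ZMod 2) (X : A) : GradedAlgebra.proj 𝒜 i X ∈ 𝒜 i := by
  rw [GradedAlgebra.proj_apply]; exact SetLike.coe_mem _

/-- Linear maps agreeing on homogeneous elements are equal. -/
theorem ext_hom {M : Type*} [AddCommGroup M] [Module ℂ M] {f g : A →ₗ[ℂ] M}
    (h : ∀ i, ∀ X ∈ 𝒜 i, f X = g X) : f = g := by
  ext X
  rw [← proj_add 𝒜 X, map_add, map_add, h 0 _ (proj_mem 𝒜 0 X), h 1 _ (proj_mem 𝒜 1 X)]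

namespace Env

/-- One step of the right recursion defining the contraction operators `contr`: for homogeneous
`X, Y` the second component is
`u⟨YX⟩ + (-1)^{p(X)p(Y)} (φ(X) Y - a φ(⟨XY⟩))`. -/
def step (a : ℂ) (Y : A) (u : Env 𝒜 a) (φ : A →ₗ[ℂ] Env 𝒜 a) : A →ₗ[ℂ] Env 𝒜 a :=
  LinearMap.mulLeft ℂ u ∘ₗ ι 𝒜 a ∘ₗ LinearMap.mulLeft ℂ Y
  + ∑ i, ∑ j, koszul i j •
      (LinearMap.mulRight ℂ (ι 𝒜 a (GradedAlgebra.proj 𝒜 j Y)) ∘ₗ φ ∘ₗ GradedAlgebra.proj 𝒜 i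
        - a • φ ∘ₗ LinearMap.mulRight ℂ (GradedAlgebra.proj 𝒜 j Y) ∘ₗ GradedAlgebra.proj 𝒜 i)

theorem step_hom (a : ℂ) {i j : ZMod 2} {X Y : A} (hX : X ∈ 𝒜 i) (hY : Y ∈ 𝒜 j)
    (u : Env 𝒜 a) (φ : A →ₗ[ℂ] Env 𝒜 a) :
    step 𝒜 a Y u φ X = u * ι 𝒜 a (Y * X) + koszul i j • (φ X * ι 𝒜 a Y - a • φ (X * Y)) := by
  have h : ∀ i' j', (i', j') ≠ (i, j) →
      φ (GradedAlgebra.proj 𝒜 i' X) * ι 𝒜 a (GradedAlgebra.proj 𝒜 j' Y)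
        - a • φ (GradedAlgebra.proj 𝒜 i' X * GradedAlgebra.proj 𝒜 j' Y) = 0 := by
    intro i' j' hne
    by_cases h1 : i = i'
    · by_cases h2 : j = j'
      · subst h1 h2; exact absurd rfl hne
      · rw [proj_ne 𝒜 h2 hY]; simp
    · rw [proj_ne 𝒜 h1 hX]; simp
  simp only [step, LinearMap.add_apply, LinearMap.comp_apply, LinearMap.mulLeft_apply,
    LinearMap.sum_apply, LinearMap.smul_apply, LinearMap.sub_apply, LinearMap.mulRight_apply]
  congr 1
  rw [← Finset.sum_product', Finset.sum_eq_single (i, j)]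
  · simp only [proj_same 𝒜 hX, proj_same 𝒜 hY]
  · rintro ⟨i', j'⟩ _ hne
    simp only [h i' j' hne, smul_zero]
  · simp

/-- The step `(u, φ) ↦ (uY, step)` as a map linear in `Y` and in `(u, φ)`. -/
def stepHom (a : ℂ) :
    A →ₗ[ℂ] (Module.End ℂ (Env 𝒜 a × (A →ₗ[ℂ] Env 𝒜 a))) :=
  LinearMap.mk₂ ℂ (fun Y x => (x.1 * ι 𝒜 a Y, step 𝒜 a Y x.1 x.2))
    (by
      intro Y Y' x
      refine Prod.ext (by simp [mul_add]) (ext_hom 𝒜 fun i X hX => ?_)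
      simp only [step, map_add, Prod.snd_add, LinearMap.add_apply, LinearMap.comp_apply,
        LinearMap.mulLeft_apply, LinearMap.sum_apply, LinearMap.smul_apply, LinearMap.sub_apply,
        LinearMap.mulRight_apply, mul_add, add_mul, smul_add, smul_sub, Finset.sum_add_distrib,
        Finset.sum_sub_distrib]
      abel)
    (by
      intro c Y x
      refine Prod.ext (by simp) (ext_hom 𝒜 fun i X hX => ?_)
      simp only [step, map_smul, Prod.smul_snd, LinearMap.add_apply, LinearMap.comp_apply,
        LinearMap.mulLeft_apply, LinearMap.sum_apply, LinearMap.smul_apply, LinearMap.sub_apply,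
        LinearMap.mulRight_apply, mul_smul_comm, smul_mul_assoc, smul_add, smul_sub,
        Finset.smul_sum]
      simp only [smul_comm c])
    (by
      intro Y x x'
      refine Prod.ext (by simp [add_mul]) (ext_hom 𝒜 fun i X hX => ?_)
      simp only [step, map_add, Prod.snd_add, Prod.fst_add, LinearMap.add_apply,
        LinearMap.comp_apply,
        LinearMap.mulLeft_apply, LinearMap.sum_apply, LinearMap.smul_apply, LinearMap.sub_apply,
        LinearMap.mulRight_apply, add_mul, smul_add, smul_sub, Finset.sum_add_distrib,
        Finset.sum_sub_distrib]
      abel)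
    (by
      intro c Y x
      refine Prod.ext (by simp) (ext_hom 𝒜 fun i X hX => ?_)
      simp only [step, map_smul, Prod.smul_snd, Prod.smul_fst, LinearMap.add_apply,
        LinearMap.comp_apply,
        LinearMap.mulLeft_apply, LinearMap.sum_apply, LinearMap.smul_apply, LinearMap.sub_apply,
        LinearMap.mulRight_apply, smul_mul_assoc, smul_add, smul_sub,
        Finset.smul_sum]
      simp only [smul_comm c])

theorem stepHom_apply (a : ℂ) (Y : A) (x : Env 𝒜 a × (A →ₗ[ℂ] Env 𝒜 a)) :
    stepHom 𝒜 a Y x = (x.1 * ι 𝒜 a Y, step 𝒜 a Y x.1 x.2) := rfl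

theorem stepHom_rel (a : ℂ) (i j : ZMod 2) (Y Z : A) (hY : Y ∈ 𝒜 i) (hZ : Z ∈ 𝒜 j)
    (x : Env 𝒜 a × (A →ₗ[ℂ] Env 𝒜 a)) :
    stepHom 𝒜 a Z (stepHom 𝒜 a Y x) - koszul i j • stepHom 𝒜 a Y (stepHom 𝒜 a Z x)
      = a • stepHom 𝒜 a (Y * Z - koszul i j • (Z * Y)) x := by
  obtain ⟨u, φ⟩ := x
  have hYZ := SetLike.mul_mem_graded hY hZ
  have hZY := SetLike.mul_mem_graded hZ hY
  simp only [map_sub, map_smul, LinearMap.sub_apply, LinearMap.smul_apply, stepHom_apply]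
  refine Prod.ext ?_ (ext_hom 𝒜 fun k X hX => ?_)
  · simp only [Prod.fst_sub, Prod.smul_fst, mul_assoc, ι_swap a hY hZ, map_sub, map_smul,
      mul_add, mul_sub, mul_smul_comm]
    module
  · have hXY := SetLike.mul_mem_graded hX hY
    have hXZ := SetLike.mul_mem_graded hX hZ
    have h1 := congrArg (u * ·) (ι_swap a hY (SetLike.mul_mem_graded hZ hX))
    have h2 := congrArg (u * ·) (ι_swap a hZ (SetLike.mul_mem_graded hY hX))
    have h3 := congrArg (φ X * ·) (ι_swap a hY hZ)
    simp only [Prod.snd_sub, Prod.smul_snd, LinearMap.sub_apply, LinearMap.smul_apply,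
      step_hom 𝒜 a hX hZ, step_hom 𝒜 a hX hY, step_hom 𝒜 a hXY hZ, step_hom 𝒜 a hXZ hY,
      step_hom 𝒜 a hX hYZ, step_hom 𝒜 a hX hZY]
    rcases zmod2_cases i with rfl | rfl <;> rcases zmod2_cases j with rfl | rfl <;>
    rcases zmod2_cases k with rfl | rfl <;>
    simp only [koszul_zero_left, koszul_zero_right, koszul_one_one, two_zmod2, add_zero,
      zero_add, one_smul, neg_smul, map_sub, map_add, mul_add, mul_sub, mul_neg, add_mul,
      sub_mul, neg_mul, smul_add, smul_sub, smul_neg, mul_smul_comm, smul_mul_assoc,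
      sub_neg_eq_add, mul_assoc] at h1 h2 h3 ⊢
    · linear_combination (norm := module) h1 - h2 + h3
    · linear_combination (norm := module) h1 - h2 + h3
    · linear_combination (norm := module) h1 - h2 + h3
    · linear_combination (norm := module) h1 - h2 - h3
    · linear_combination (norm := module) h1 - h2 + h3
    · linear_combination (norm := module) h1 - h2 - h3
    · linear_combination (norm := module) h1 + h2 + h3
    · linear_combination (norm := module) h1 + h2 + h3

/-- The contraction operator `E_X` on `Env 𝒜 a`: `contr 𝒜 a u X = E_X(u)` is determined by
`E_X(1) = 0` and, for homogeneous `X` and `Y`,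
`E_X(uY) = u⟨YX⟩ + (-1)^{p(X)p(Y)} (E_X(u) Y - a E_{⟨XY⟩}(u))`.
For `a = 0` it is the right superderivation of `S(A)` with `Y ↦ ⟨YX⟩` on generators. -/
def contr (a : ℂ) (u : Env 𝒜 a) : A →ₗ[ℂ] Env 𝒜 a :=
  (rightAct a (stepHom 𝒜 a) (stepHom_rel 𝒜 a) u (1, 0)).2

theorem rightAct_fst (a : ℂ) (u : Env 𝒜 a) :
    (rightAct a (stepHom 𝒜 a) (stepHom_rel 𝒜 a) u (1, 0)).1 = u := by
  induction u using induction_right with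
  | one => rw [rightAct_one]
  | add u v hu hv => rw [map_add, LinearMap.add_apply, Prod.fst_add, hu, hv]
  | smul c u hu => rw [map_smul, LinearMap.smul_apply, Prod.smul_fst, hu]
  | mul u X hu => rw [rightAct_mul_ι, stepHom_apply, hu]

variable {𝒜}

@[simp] theorem contr_one (a : ℂ) : contr 𝒜 a 1 = 0 := by
  rw [contr, rightAct_one]

@[simp] theorem contr_add (a : ℂ) (u v : Env 𝒜 a) :
    contr 𝒜 a (u + v) = contr 𝒜 a u + contr 𝒜 a v := by
  simp [contr]

@[simp] theorem contr_smul (a c : ℂ) (u : Env 𝒜 a) :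
    contr 𝒜 a (c • u) = c • contr 𝒜 a u := by
  simp [contr]

@[simp] theorem contr_sub (a : ℂ) (u v : Env 𝒜 a) :
    contr 𝒜 a (u - v) = contr 𝒜 a u - contr 𝒜 a v := by
  rw [sub_eq_add_neg, sub_eq_add_neg, ← neg_one_smul ℂ v, ← neg_one_smul ℂ (contr 𝒜 a v),
    contr_add, contr_smul]

theorem contr_mul_ι (a : ℂ) {i j : ZMod 2} {X Y : A} (hX : X ∈ 𝒜 i) (hY : Y ∈ 𝒜 j)
    (u : Env 𝒜 a) :
    contr 𝒜 a (u * ι 𝒜 a Y) X = u * ι 𝒜 a (Y * X)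
      + koszul i j • (contr 𝒜 a u X * ι 𝒜 a Y - a • contr 𝒜 a u (X * Y)) := by
  rw [contr, rightAct_mul_ι, stepHom_apply, step_hom 𝒜 a hX hY, rightAct_fst]
  rfl

theorem induction_hom {a : ℂ} {C : Env 𝒜 a → Prop} (one : C 1)
    (add : ∀ u v, C u → C v → C (u + v)) (smul : ∀ (c : ℂ) u, C u → C (c • u))
    (mul : ∀ u (i : ZMod 2), ∀ X ∈ 𝒜 i, C u → C (u * ι 𝒜 a X)) (u : Env 𝒜 a) : C u := by
  refine induction_right one add smul (fun u X hu => ?_) u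
  rw [← proj_add 𝒜 X, map_add, mul_add]
  exact add _ _ (mul u 0 _ (proj_mem 𝒜 0 X) hu) (mul u 1 _ (proj_mem 𝒜 1 X) hu)

/-- The contractions `E_X` form a right action of the Lie superalgebra `A`. -/
theorem contr_comm (a : ℂ) (u : Env 𝒜 a) : ∀ (i j : ZMod 2) (X Y : A), X ∈ 𝒜 i → Y ∈ 𝒜 j →
    contr 𝒜 a (contr 𝒜 a u X) Y - koszul i j • contr 𝒜 a (contr 𝒜 a u Y) X
      = contr 𝒜 a u (X * Y) - koszul i j • contr 𝒜 a u (Y * X) := by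
  induction u using induction_hom with
  | one =>
    intro i j X Y hX hY
    have h : contr 𝒜 a (0 : Env 𝒜 a) = 0 := by simpa using contr_smul (𝒜 := 𝒜) a 0 0
    simp [h]
  | add u v hu hv =>
    intro i j X Y hX hY
    simp only [contr_add, LinearMap.add_apply, smul_add]
    linear_combination (norm := module) hu i j X Y hX hY + hv i j X Y hX hY
  | smul c u hu =>
    intro i j X Y hX hY
    simp only [contr_smul, LinearMap.smul_apply]
    linear_combination (norm := module) c • hu i j X Y hX hY
  | mul u k Z hZ hu =>
    intro i j X Y hX hY
    have hXY := SetLike.mul_mem_graded hX hY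
    have hYX := SetLike.mul_mem_graded hY hX
    have hXZ := SetLike.mul_mem_graded hX hZ
    have hYZ := SetLike.mul_mem_graded hY hZ
    have hZX := SetLike.mul_mem_graded hZ hX
    have hZY := SetLike.mul_mem_graded hZ hY
    have h1 := congrArg (· * ι 𝒜 a Z) (hu i j X Y hX hY)
    have h2 := hu _ _ X (Y * Z) hX hYZ
    have h3 := hu _ _ (X * Z) Y hXZ hY
    simp only [contr_mul_ι a hX hZ, contr_mul_ι a hY hZ, contr_mul_ι a hXY hZ,
      contr_mul_ι a hYX hZ, contr_add, contr_sub, contr_smul, LinearMap.add_apply,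
      LinearMap.sub_apply, LinearMap.smul_apply, contr_mul_ι a hX hZY, contr_mul_ι a hY hZX]
    rcases zmod2_cases i with rfl | rfl <;> rcases zmod2_cases j with rfl | rfl <;>
    rcases zmod2_cases k with rfl | rfl <;>
    simp only [koszul_zero_left, koszul_zero_right, koszul_one_one, two_zmod2, add_zero,
      zero_add, one_smul, neg_smul, sub_mul, add_mul,
      sub_neg_eq_add, mul_assoc] at h1 h2 h3 ⊢
    · linear_combination (norm := module) h1 - a • h2 - a • h3
    · linear_combination (norm := module) h1 - a • h2 - a • h3
    · linear_combination (norm := module) h1 - a • h2 - a • h3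
    · linear_combination (norm := module) -h1 + a • h2 - a • h3
    · linear_combination (norm := module) h1 - a • h2 - a • h3
    · linear_combination (norm := module) -h1 + a • h2 + a • h3
    · linear_combination (norm := module) h1 - a • h2 - a • h3
    · linear_combination (norm := module) h1 - a • h2 + a • h3

/-- The operation `u * X = u X + (b - a) E_X(u)` on `Env 𝒜 a`. -/
def starOp (a b : ℂ) : A →ₗ[ℂ] Module.End ℂ (Env 𝒜 a) :=
  LinearMap.mk₂ ℂ (fun X u => u * ι 𝒜 a X + (b - a) • contr 𝒜 a u X)
    (by intro X Y u; simp only [map_add, mul_add, smul_add]; abel)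
    (by intro c X u; simp only [map_smul, mul_smul_comm, smul_add, smul_comm c])
    (by intro X u v; simp only [contr_add, LinearMap.add_apply, add_mul, smul_add]; abel)
    (by intro c X u; simp only [contr_smul, LinearMap.smul_apply, smul_mul_assoc, smul_add,
          smul_comm c])

theorem starOp_apply (a b : ℂ) (X : A) (u : Env 𝒜 a) :
    starOp a b X u = u * ι 𝒜 a X + (b - a) • contr 𝒜 a u X := rfl

theorem starOp_rel (a b : ℂ) (i j : ZMod 2) (X Y : A) (hX : X ∈ 𝒜 i) (hY : Y ∈ 𝒜 j)
    (u : Env 𝒜 a) :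
    starOp a b Y (starOp a b X u) - koszul i j • starOp a b X (starOp a b Y u)
      = b • starOp a b (X * Y - koszul i j • (Y * X)) u := by
  have h1 := congrArg (u * ·) (ι_swap a hX hY)
  have h2 := contr_comm a u i j X Y hX hY
  simp only [starOp_apply, contr_add, contr_smul, LinearMap.add_apply, LinearMap.smul_apply,
    contr_mul_ι a hX hY, contr_mul_ι a hY hX]
  rcases zmod2_cases i with rfl | rfl <;> rcases zmod2_cases j with rfl | rfl <;>
  simp only [koszul_zero_left, koszul_zero_right, koszul_one_one, one_smul, neg_smul,
    add_mul, smul_mul_assoc, sub_neg_eq_add, mul_assoc, map_add, map_sub, mul_add,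
    mul_sub, mul_neg, mul_smul_comm, smul_add, smul_sub] at h1 h2 ⊢
  · linear_combination (norm := module) h1 + (b - a) • (b - a) • h2
  · linear_combination (norm := module) h1 + (b - a) • (b - a) • h2
  · linear_combination (norm := module) h1 + (b - a) • (b - a) • h2
  · linear_combination (norm := module) h1 + (b - a) • (b - a) • h2

/-- The linear map `Env 𝒜 b → Env 𝒜 a` defined through the operation `*` on `Env 𝒜 a`, sending
`X₁ X₂ ⋯ X_k` to `((⋯(X₁ * X₂) * ⋯) * X_{k-1}) * X_k`. -/
def transfer (b a : ℂ) : Env 𝒜 b →ₗ[ℂ] Env 𝒜 a :=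
  (LinearMap.applyₗ (1 : Env 𝒜 a)) ∘ₗ rightAct b (starOp a b) (starOp_rel a b)

@[simp] theorem transfer_one (b a : ℂ) : transfer b a (1 : Env 𝒜 b) = 1 :=
  rightAct_one _ _ _ _

theorem transfer_mul_ι (b a : ℂ) (u : Env 𝒜 b) (X : A) :
    transfer b a (u * ι 𝒜 b X) = starOp a b X (transfer b a u) :=
  rightAct_mul_ι _ _ _ _ _ _

theorem transfer_contr (b a : ℂ) (u : Env 𝒜 b) : ∀ (i : ZMod 2) (X : A), X ∈ 𝒜 i →
    transfer b a (contr 𝒜 b u X) = contr 𝒜 a (transfer b a u) X := by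
  induction u using induction_hom with
  | one => simp
  | add u v hu hv =>
    intro i X hX
    simp only [contr_add, map_add, LinearMap.add_apply, hu i X hX, hv i X hX]
  | smul c u hu =>
    intro i X hX
    simp only [contr_smul, map_smul, LinearMap.smul_apply, hu i X hX]
  | mul u k Z hZ hu =>
    intro i X hX
    have h := contr_comm a (transfer b a u) i k X Z hX hZ
    rw [contr_mul_ι b hX hZ, transfer_mul_ι, starOp_apply, contr_add, contr_smul,
      LinearMap.add_apply, LinearMap.smul_apply, contr_mul_ι a hX hZ]
    simp only [map_add, map_sub, map_smul, transfer_mul_ι, starOp_apply, hu i X hX,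
      hu _ _ (SetLike.mul_mem_graded hX hZ)]
    rcases zmod2_cases i with rfl | rfl <;> rcases zmod2_cases k with rfl | rfl <;>
    simp only [koszul_zero_left, koszul_zero_right, koszul_one_one, one_smul, neg_smul] at h ⊢
    · linear_combination (norm := module) (b - a) • h
    · linear_combination (norm := module) (b - a) • h
    · linear_combination (norm := module) (b - a) • h
    · linear_combination (norm := module) - (b - a) • h

theorem transfer_transfer (b a : ℂ) (u : Env 𝒜 b) : transfer a b (transfer b a u) = u := by
  induction u using induction_hom with
  | one => simp
  | add u v hu hv => rw [map_add, map_add, hu, hv]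
  | smul c u hu => rw [map_smul, map_smul, hu]
  | mul u k Z hZ hu =>
    rw [transfer_mul_ι, starOp_apply, map_add, map_smul, transfer_mul_ι, starOp_apply,
      transfer_contr _ _ _ k Z hZ, hu]
    module

end Env

/-- The map `σ̃ : U(A) → S(A)`, `X₁ X₂ ⋯ X_k ↦ ((⋯(X₁ * X₂) * ⋯) * X_{k-1}) * X_k`. -/
def sigmaTilde : SuperEnv 𝒜 ≃ₗ[ℂ] SuperSym 𝒜 :=
  LinearEquiv.ofLinearMap (Env.transfer 1 0) (Env.transfer 0 1)
    (LinearMap.ext (Env.transfer_transfer 0 1)) (LinearMap.ext (Env.transfer_transfer 1 0))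

/-- The special symmetrization `σ = σ̃⁻¹ : S(A) → U(A)`. -/
def specialSymm : SuperSym 𝒜 ≃ₗ[ℂ] SuperEnv 𝒜 := (sigmaTilde 𝒜).symm

theorem sigmaTilde_one : sigmaTilde 𝒜 1 = 1 := Env.transfer_one 1 0

/-- `σ̃(uX) = σ̃(u) * X`. -/
theorem sigmaTilde_mul_ι (u : SuperEnv 𝒜) (X : A) :
    sigmaTilde 𝒜 (u * Env.ι 𝒜 1 X) = Env.starOp 0 1 X (sigmaTilde 𝒜 u) :=
  Env.transfer_mul_ι 1 0 u X

/-- The operation `*` on `S(A)`, explicitly: for homogeneous `Y₁, …, Y_k, X`,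
`(Y₁ ⋯ Y_k) * X = Y₁ ⋯ Y_k X + ∑_r (-1)^{P(r)} Y₁ ⋯ Y_{r-1} ⟨Y_r X⟩ Y_{r+1} ⋯ Y_k`, where
`P(r) = ∑_{s > r} p(Y_s) p(X)`. -/
theorem starOp_prod {i : ZMod 2} {X : A} (hX : X ∈ 𝒜 i) (k : ℕ) (p : Fin k → ZMod 2)
    (Y : Fin k → A) (hY : ∀ r, Y r ∈ 𝒜 (p r)) :
    Env.starOp 0 1 X (List.ofFn fun r => Env.ι 𝒜 0 (Y r)).prod
      = (List.ofFn fun r => Env.ι 𝒜 0 (Y r)).prod * Env.ι 𝒜 0 X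
        + ∑ r, (∏ s ∈ Finset.Ioi r, koszul (p s) i) •
            (List.ofFn fun s => Env.ι 𝒜 0 (Function.update Y r (Y r * X) s)).prod := by
  rw [Env.starOp_apply, sub_zero, one_smul, add_right_inj]
  induction k with
  | zero => simp
  | succ k ih =>
    have hIoi (m : ℕ) (f : Fin m → ℂ) (r : Fin m) :
        ∏ s ∈ Finset.Ioi r, f s = ∏ s, if r < s then f s else 1 := by
      rw [← Finset.prod_filter]; congr 1; ext s; simp
    simp only [hIoi] at ih ⊢
    have hlast (r : Fin k) : Function.update Y r.castSucc (Y r.castSucc * X) (Fin.last k)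
        = Y (Fin.last k) := Function.update_of_ne (Fin.castSucc_lt_last r).ne' _ _
    have hne (r s : Fin k) : Function.update Y r.castSucc (Y r.castSucc * X) s.castSucc
        = Function.update (fun t : Fin k => Y t.castSucc) r (Y r.castSucc * X) s := by
      simp [Function.update_apply]
    have hne' (s : Fin k) : Function.update Y (Fin.last k) (Y (Fin.last k) * X) s.castSucc
        = Y s.castSucc := Function.update_of_ne (Fin.castSucc_lt_last s).ne _ _
    have hlt (s : Fin k) : ¬ Fin.last k < s.castSucc := not_lt.2 (Fin.le_last _)
    simp only [List.ofFn_succ', List.concat_eq_append, List.prod_append, List.prod_singleton,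
      Fin.sum_univ_castSucc, Fin.prod_univ_castSucc, Fin.castSucc_lt_castSucc_iff,
      Fin.castSucc_lt_last, hlast, hne, hne', hlt, Function.update_self, lt_irrefl, if_true,
      if_false, Finset.prod_const_one, one_smul, mul_one]
    rw [Env.contr_mul_ι 0 hX (hY _), ih (fun r => p r.castSucc) (fun r => Y r.castSucc)
      (fun r => hY _), zero_smul, sub_zero, add_comm, Finset.sum_mul, Finset.smul_sum]
    congr 1
    refine Finset.sum_congr rfl fun r _ => ?_
    rw [smul_mul_assoc, smul_smul, koszul_comm i, mul_comm (koszul _ _)]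

end Enveloping
section Queer

/-- The index set `{1, …, 2n}` of the standard basis of `ℂ^{n|n}`: `inl` for the even indices
`1, …, n`, `inr` for the odd indices `n + 1, …, 2n`. The involution `δ(i) ≡ i + n mod 2n` is
`Sum.swap`. -/
abbrev Idx (n : ℕ) : Type := Fin n ⊕ Fin n

/-- The parity of an index. -/
def par {n : ℕ} : Idx n → ZMod 2 := Sum.elim (fun _ => 0) (fun _ => 1)

theorem par_swap {n : ℕ} (i : Idx n) : par i.swap = par i + 1 := by
  rcases i with i | i <;> rfl

theorem fromBlocks_iff {n : ℕ} {M : Matrix (Idx n) (Idx n) ℂ} :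
    (∃ A B, M = Matrix.fromBlocks A B B A) ↔ ∀ i j, M i.swap j.swap = M i j := by
  constructor
  · rintro ⟨A, B, rfl⟩ (i | i) (j | j) <;> rfl
  · intro h
    refine ⟨M.toBlocks₁₁, M.toBlocks₁₂, ?_⟩
    ext (i | i) (j | j)
    · rfl
    · rfl
    · exact h (.inl i) (.inr j)
    · exact h (.inl i) (.inl j)

/-- The matrix superalgebra `Q(n)`. -/
def Q (n : ℕ) : Subalgebra ℂ (Matrix (Idx n) (Idx n) ℂ) where
  carrier := {M | ∃ A B : Matrix (Fin n) (Fin n) ℂ, M = Matrix.fromBlocks A B B A}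
  mul_mem' := by
    rintro _ _ ⟨A, B, rfl⟩ ⟨C, D, rfl⟩
    refine ⟨A * C + B * D, A * D + B * C, ?_⟩
    rw [Matrix.fromBlocks_multiply, add_comm (B * C), add_comm (B * D)]
  add_mem' := by
    rintro _ _ ⟨A, B, rfl⟩ ⟨C, D, rfl⟩
    exact ⟨A + C, B + D, Matrix.fromBlocks_add _ _ _ _ _ _ _ _⟩
  algebraMap_mem' c := by
    refine ⟨algebraMap ℂ _ c, 0, ?_⟩
    ext (i | i) (j | j) <;> simp [Matrix.algebraMap_matrix_apply]

theorem mem_Q {n : ℕ} {M : Matrix (Idx n) (Idx n) ℂ} :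
    M ∈ Q n ↔ ∀ i j, M i.swap j.swap = M i j := fromBlocks_iff

/-- The `ℤ/2`-grading of `Q(n)`: a matrix has parity `d` if its entries `M i j` vanish unless
`p(i) + p(j) = d`. -/
def Qgr (n : ℕ) (d : ZMod 2) : Submodule ℂ (Q n) where
  carrier := {M | ∀ i j, par i + par j ≠ d → M.1 i j = 0}
  add_mem' := by
    intro M M' h h' i j hij
    change M.1 i j + M'.1 i j = 0
    rw [h i j hij, h' i j hij, add_zero]
  zero_mem' := fun _ _ _ => rfl
  smul_mem' := by
    intro c M h i j hij
    change c * M.1 i j = 0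
    rw [h i j hij, mul_zero]

/-- The component of parity `d` of a matrix. -/
def Qcomp (n : ℕ) (d : ZMod 2) : Q n →ₗ[ℂ] Qgr n d where
  toFun M := ⟨⟨Matrix.of fun i j => if par i + par j = d then M.1 i j else 0, mem_Q.2 (by
      intro i j
      have h : par i + 1 + (par j + 1) = par i + par j := by
        rw [add_add_add_comm, two_zmod2, add_zero]
      simp only [Matrix.of_apply, par_swap, h, mem_Q.1 M.2 i j])⟩,
    fun i j hij => if_neg hij⟩
  map_add' M M' := by
    ext i j
    by_cases h : par i + par j = d <;> simp [h]
  map_smul' c M := by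
    ext i j
    by_cases h : par i + par j = d <;> simp [h]

theorem Qcomp_apply (n : ℕ) (d : ZMod 2) (M : Q n) (i j : Idx n) :
    (Qcomp n d M).1.1 i j = if par i + par j = d then M.1 i j else 0 := rfl

instance (n : ℕ) : SetLike.GradedMonoid (Qgr n) where
  one_mem := by
    intro i j hij
    refine Matrix.one_apply_ne ?_
    rintro rfl
    exact hij (CharTwo.add_self_eq_zero _)
  mul_mem := by
    intro d e M M' hM hM' i j hij
    change (M.1 * M'.1) i j = 0
    rw [Matrix.mul_apply]
    refine Finset.sum_eq_zero fun k _ => ?_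
    by_cases h : par i + par k = d
    · by_cases h' : par k + par j = e
      · refine absurd ?_ hij
        rw [← h, ← h', add_assoc, ← add_assoc (par k), CharTwo.add_self_eq_zero, zero_add]
      · rw [hM' k j h', mul_zero]
    · rw [hM i k h, zero_mul]

instance (n : ℕ) : DirectSum.Decomposition (Qgr n) :=
  DirectSum.Decomposition.ofLinearMap (Qgr n)
    (∑ d, DirectSum.lof ℂ (ZMod 2) (fun d => Qgr n d) d ∘ₗ Qcomp n d)
    (by
      ext M i j
      simp only [LinearMap.comp_apply, LinearMap.sum_apply, map_sum, DirectSum.coeLinearMap_lof,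
        LinearMap.id_apply]
      rw [show (∑ d, ((Qcomp n d M : Qgr n d) : Q n))
        = (Qcomp n 0 M : Q n) + (Qcomp n 1 M : Q n) from Fin.sum_univ_two _]
      change (Qcomp n 0 M).1.1 i j + (Qcomp n 1 M).1.1 i j = M.1 i j
      rw [Qcomp_apply, Qcomp_apply]
      rcases zmod2_cases (par i + par j) with h | h <;> simp [h])
    (by
      refine DirectSum.linearMap_ext ℂ fun d => LinearMap.ext fun M => ?_
      simp only [LinearMap.comp_apply, LinearMap.sum_apply, DirectSum.coeLinearMap_lof,
        LinearMap.id_apply]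
      rw [Finset.sum_eq_single d]
      · congr 1
        ext i j
        rw [Qcomp_apply]
        split_ifs with h
        · rfl
        · exact (M.2 i j h).symm
      · intro e _ he
        have : Qcomp n e M.1 = 0 := by
          ext i j
          rw [Qcomp_apply]
          split_ifs with h
          · exact M.2 i j (by rw [h]; exact he)
          · rfl
        rw [this, map_zero]
      · simp)

instance (n : ℕ) : GradedAlgebra (Qgr n) where

/-- The element `F_{ij} = E_{ij} + E_{δ(i)δ(j)}` of `Q(n)`. -/
def F {n : ℕ} (i j : Idx n) : Q n :=
  ⟨Matrix.single i j 1 + Matrix.single i.swap j.swap 1, mem_Q.2 (by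
    intro k l
    have h (a b : Idx n) : a = b.swap ↔ a.swap = b := by
      rcases a with a | a <;> rcases b with b | b <;> simp
    simp only [Matrix.add_apply, Matrix.single_apply, h, Sum.swap_swap]
    exact add_comm _ _)⟩

/-- `J_k = ∑ (-1)^{p(i₂) + ⋯ + p(i_k)} F_{i₁ i₂} F_{i₂ i₃} ⋯ F_{i_k i₁} ∈ S(Q(n))`, summed over all
`i₁, …, i_k ∈ {1, …, 2n}`. -/
def J (n k : ℕ) : SuperSym (Qgr n) :=
  ∑ i : Fin k → Idx n,
    (∏ t : Fin k, if (t : ℕ) = 0 then 1 else (-1 : ℂ) ^ (par (i t)).val) •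
      (List.ofFn fun t : Fin k => Env.ι (Qgr n) 0 (F (i t) (i (finRotate k t)))).prod

/-- `J_ρ = J_{ρ₁} ⋯ J_{ρ_l}`. -/
def JList (n : ℕ) (ρ : List ℕ) : SuperSym (Qgr n) := (ρ.map (J n)).prod

end Queer

section Tensor

/-- The tensor space `(ℂ^{n|n})^{⊗N}`. -/
abbrev Tens (n N : ℕ) : Type := ⨂[ℂ] _ : Fin N, (Idx n → ℂ)

/-- The parity operator `v ↦ (-1)^{p(v)} v` of `ℂ^{n|n}`. -/
def parityOp (n : ℕ) : Module.End ℂ (Idx n → ℂ) :=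
  Matrix.toLin' (Matrix.diagonal fun i => (-1 : ℂ) ^ (par i).val)

/-- `slot d t X` is the operator `1 ⊗ ⋯ ⊗ X ⊗ ⋯ ⊗ 1` on the tensor space, with an operator `X` of
parity `d` at the place `t`. By the rule of signs it multiplies
`v₁ ⊗ ⋯ ⊗ v_N` by `(-1)^{d (p(v₁) + ⋯ + p(v_{t-1}))}` and replaces `v_t` by `X v_t`. -/
def slot {n N : ℕ} (d : ZMod 2) (t : Fin N) :
    Module.End ℂ (Idx n → ℂ) →ₗ[ℂ] Module.End ℂ (Tens n N) :=
  (PiTensorProduct.mapMultilinear ℂ (fun _ : Fin N => (Idx n → ℂ))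
    (fun _ : Fin N => (Idx n → ℂ))).toLinearMap
      (fun s => if s < t then parityOp n ^ d.val else 1) t

theorem slot_apply {n N : ℕ} (d : ZMod 2) (t : Fin N) (X : Module.End ℂ (Idx n → ℂ)) :
    slot d t X = PiTensorProduct.map (Function.update
      (fun s : Fin N => if s < t then parityOp n ^ d.val else 1) t X) := rfl

theorem parityOp_sq (n : ℕ) : parityOp n * parityOp n = 1 := by
  rw [parityOp, Module.End.mul_eq_comp, ← Matrix.toLin'_mul, Matrix.diagonal_mul_diagonal]
  have : (fun i : Idx n => (-1 : ℂ) ^ (par i).val * (-1 : ℂ) ^ (par i).val) = 1 := by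
    funext i
    rw [← mul_pow]
    simp
  rw [this]
  exact (congrArg _ Matrix.diagonal_one).trans Matrix.toLin'_one

theorem parityOp_pow_add (n : ℕ) (d e : ZMod 2) :
    parityOp n ^ d.val * parityOp n ^ e.val = parityOp n ^ (d + e).val := by
  have h1 : (1 : ZMod 2).val = 1 := rfl
  rcases zmod2_cases d with rfl | rfl <;> rcases zmod2_cases e with rfl | rfl <;>
    simp [h1, parityOp_sq]

/-- The operator `X` of `ℂ^{n|n}` is homogeneous of parity `d`. -/
def HasParity {n : ℕ} (d : ZMod 2) (X : Module.End ℂ (Idx n → ℂ)) : Prop :=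
  parityOp n * X = koszul 1 d • (X * parityOp n)

theorem HasParity.pow {n : ℕ} {d : ZMod 2} {X : Module.End ℂ (Idx n → ℂ)} (h : HasParity d X)
    (e : ZMod 2) : parityOp n ^ e.val * X = koszul d e • (X * parityOp n ^ e.val) := by
  have h1 : (1 : ZMod 2).val = 1 := rfl
  rcases zmod2_cases e with rfl | rfl
  · simp
  · rw [h1, pow_one, koszul_comm]; exact h

theorem slot_mul_same {n N : ℕ} (d e : ZMod 2) (t : Fin N) (X Y : Module.End ℂ (Idx n → ℂ)) :
    slot d t X * slot e t Y = slot (d + e) t (X * Y) := by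
  rw [slot_apply, slot_apply, slot_apply, ← PiTensorProduct.map_mul]
  congr 1
  funext s
  by_cases h : s = t
  · subst h; simp
  · by_cases h' : s < t <;> simp [h, h', parityOp_pow_add]

theorem slot_mul_lt {n N : ℕ} {d e : ZMod 2} {s t : Fin N} (hst : s < t)
    {X Y : Module.End ℂ (Idx n → ℂ)} (hX : HasParity d X) :
    slot e t Y * slot d s X = koszul d e • (slot d s X * slot e t Y) := by
  simp only [slot_apply, ← PiTensorProduct.map_mul]
  rw [← Function.update_eq_self (β := fun _ => Module.End ℂ (Idx n → ℂ)) s (fun i =>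
        Function.update (fun r => if r < s then parityOp n ^ d.val else 1) s X i *
          Function.update (fun r => if r < t then parityOp n ^ e.val else 1) t Y i),
    ← PiTensorProduct.map_update_smul]
  congr 1
  funext r
  by_cases hr : r = s
  · subst hr
    simp [hst.ne, hst, hX.pow]
  · by_cases hr' : r = t
    · subst hr'; simp [hr, not_lt.2 hst.le]
    · by_cases h1 : r < s <;> by_cases h2 : r < t <;> simp [hr, hr', h1, h2, ← pow_add, add_comm]

theorem slot_comm {n N : ℕ} {d e : ZMod 2} {s t : Fin N} (hst : s ≠ t)
    {X Y : Module.End ℂ (Idx n → ℂ)} (hX : HasParity d X) (hY : HasParity e Y) :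
    slot d s X * slot e t Y = koszul d e • (slot e t Y * slot d s X) := by
  rcases lt_or_gt_of_ne hst with h | h
  · rw [slot_mul_lt h hX, smul_smul, koszul_sq, one_smul]
  · rw [slot_mul_lt h hY, koszul_comm]

/-- The action of a matrix in `Q(n)` on `ℂ^{n|n}`. -/
def vecRep (n : ℕ) : Q n →ₐ[ℂ] Module.End ℂ (Idx n → ℂ) :=
  (Matrix.toLinAlgEquiv' (R := ℂ) (n := Idx n)).toAlgHom.comp (Q n).val

theorem hasParity_vecRep {n : ℕ} {d : ZMod 2} {X : Q n} (hX : X ∈ Qgr n d) :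
    HasParity d (vecRep n X) := by
  change Matrix.toLin' _ * Matrix.toLin' X.1 = koszul 1 d • (Matrix.toLin' X.1 * Matrix.toLin' _)
  rw [Module.End.mul_eq_comp, Module.End.mul_eq_comp, ← Matrix.toLin'_mul, ← Matrix.toLin'_mul,
    ← map_smul]
  congr 1
  ext i j
  rw [Matrix.diagonal_mul, Matrix.smul_apply, Matrix.mul_diagonal, smul_eq_mul]
  by_cases h : par i + par j = d
  · subst h
    rcases i with i | i <;> rcases j with j | j <;> simp [par, mul_comm]
  · simp [hX i j h]

/-- The action of `X ∈ Q(n)` on the tensor space, `∑_t 1 ⊗ ⋯ ⊗ X ⊗ ⋯ ⊗ 1` (with the rule of signs;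
a general `X` is the sum of its components `X_d` of parity `d`). -/
def lieAct (n N : ℕ) : Q n →ₗ[ℂ] Module.End ℂ (Tens n N) :=
  ∑ t : Fin N, ∑ d : ZMod 2,
    slot d t ∘ₗ (vecRep n).toLinearMap ∘ₗ GradedAlgebra.proj (Qgr n) d

theorem lieAct_hom {n N : ℕ} {d : ZMod 2} {X : Q n} (hX : X ∈ Qgr n d) :
    lieAct n N X = ∑ t : Fin N, slot d t (vecRep n X) := by
  simp only [lieAct, LinearMap.sum_apply, LinearMap.comp_apply]
  refine Finset.sum_congr rfl fun t _ => ?_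
  rw [Finset.sum_eq_single d]
  · rw [proj_same _ hX]; rfl
  · intro e _ he
    rw [proj_ne _ he.symm hX]; simp
  · simp

theorem sub_smul_eq_of_add {B : Type*} [AddCommGroup B] [Module ℂ B] {x y z w : B} {c : ℂ}
    (h : x + c • w = z + c • y) : x - c • y = z - c • w :=
  sub_eq_sub_iff_add_eq_add.2 h

/-- The representation `γ_N` of `U(Q(n))` in the tensor space. -/
def gammaRep (n N : ℕ) : SuperEnv (Qgr n) →ₐ[ℂ] Module.End ℂ (Tens n N) :=
  Env.lift (𝒜 := Qgr n) (B := Module.End ℂ (Tens n N)) 1 (lieAct n N) (by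
    intro i j X Y hX hY
    have h : lieAct n N X * lieAct n N Y + koszul i j • lieAct n N (Y * X)
        = lieAct n N (X * Y) + koszul i j • (lieAct n N Y * lieAct n N X) := by
      rw [lieAct_hom hX, lieAct_hom hY, lieAct_hom (SetLike.mul_mem_graded hX hY),
        lieAct_hom (SetLike.mul_mem_graded hY hX), Finset.sum_mul_sum, Finset.sum_mul_sum,
        Finset.sum_comm (f := fun s t => slot j s (vecRep n Y) * slot i t (vecRep n X))]
      simp only [Finset.smul_sum]
      rw [← Finset.sum_add_distrib, ← Finset.sum_add_distrib]
      refine Finset.sum_congr rfl fun s _ => ?_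
      rw [← Finset.add_sum_erase _ _ (Finset.mem_univ s), ← Finset.add_sum_erase Finset.univ
        (fun t => koszul i j • (slot j t (vecRep n Y) * slot i s (vecRep n X)))
        (Finset.mem_univ s), slot_mul_same, slot_mul_same, map_mul (vecRep n) X Y,
        map_mul (vecRep n) Y X,
        Finset.sum_congr rfl fun t ht => slot_comm (Finset.ne_of_mem_erase ht).symm
          (hasParity_vecRep hX) (hasParity_vecRep hY), add_right_comm, add_assoc]
    rw [one_smul, map_sub, map_smul]
    exact sub_smul_eq_of_add (B := Module.End ℂ (Tens n N)) h)

/-- The standard basis `e_{i₁} ⊗ ⋯ ⊗ e_{i_N}` of the tensor space. -/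
def tensBasis (n N : ℕ) : Module.Basis (Fin N → Idx n) ℂ (Tens n N) :=
  Basis.piTensorProduct fun _ => Pi.basisFun ℂ (Idx n)

/-- The sign `c(p, τ)` produced by permuting homogeneous vectors of parities `p` by `τ`: the
product of `(-1)^{p_i p_j}` over the inversions `i < j`, `τ(j) < τ(i)`. -/
def permSign {N : ℕ} (p : Fin N → ZMod 2) (τ : Equiv.Perm (Fin N)) : ℂ :=
  ∏ i, ∏ j, if i < j ∧ τ j < τ i then koszul (p i) (p j) else 1

theorem prod_prod_congr {N : ℕ} {g h : Fin N → Fin N → ℂ} (hd : ∀ i, g i i = h i i)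
    (hlt : ∀ i j, i < j → g i j * g j i = h i j * h j i) :
    ∏ i, ∏ j, g i j = ∏ i, ∏ j, h i j := by
  have key (f : Fin N → Fin N → ℂ) : ∏ i, ∏ j, f i j =
      (∏ i, ∏ j, if i < j then f i j * f j i else 1) * ∏ i, ∏ j, if i = j then f i i else 1 := by
    have h1 : ∏ i, ∏ j, f i j = (∏ i, ∏ j, if i < j then f i j else 1)
        * (∏ i, ∏ j, if j < i then f i j else 1) * ∏ i, ∏ j, if i = j then f i i else 1 := by
      simp only [← Finset.prod_mul_distrib]
      refine Finset.prod_congr rfl fun i _ => Finset.prod_congr rfl fun j _ => ?_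
      rcases lt_trichotomy i j with h | h | h
      · simp [h, h.ne, h.le]
      · subst h; simp
      · simp [h, h.ne', h.le]
    rw [h1, Finset.prod_comm (f := fun i j => if j < i then f i j else 1)]
    simp only [← Finset.prod_mul_distrib]
    refine Finset.prod_congr rfl fun i _ => Finset.prod_congr rfl fun j _ => ?_
    by_cases h : i < j <;> simp [h]
  rw [key g, key h]
  congr 1
  · refine Finset.prod_congr rfl fun i _ => Finset.prod_congr rfl fun j _ => ?_
    by_cases h' : i < j
    · simp only [h', if_true, hlt i j h']
    · simp [h']
  · simp only [hd]

theorem permSign_one {N : ℕ} (p : Fin N → ZMod 2) : permSign p 1 = 1 := by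
  refine Finset.prod_eq_one fun i _ => Finset.prod_eq_one fun j _ => if_neg ?_
  rintro ⟨h1, h2⟩
  exact absurd h1 (not_lt.2 h2.le)

theorem permSign_mul {N : ℕ} (p : Fin N → ZMod 2) (σ τ : Equiv.Perm (Fin N)) :
    permSign p (σ * τ) = permSign (p ∘ τ.symm) σ * permSign p τ := by
  have h : permSign (p ∘ τ.symm) σ
      = ∏ i, ∏ j, if τ i < τ j ∧ σ (τ j) < σ (τ i) then koszul (p i) (p j) else 1 := by
    rw [permSign, ← Equiv.prod_comp τ]
    refine Finset.prod_congr rfl fun i _ => ?_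
    rw [← Equiv.prod_comp τ]
    simp
  rw [h, permSign, permSign]
  simp only [← Finset.prod_mul_distrib]
  refine prod_prod_congr (fun i => by simp) fun i j hij => ?_
  have h1 : τ i ≠ τ j := fun e => hij.ne (τ.injective e)
  have h2 : σ (τ i) ≠ σ (τ j) := fun e => h1 (σ.injective e)
  have hk := koszul_sq (p i) (p j)
  simp only [Equiv.Perm.mul_apply, hij, not_lt.2 hij.le, true_and, false_and, if_false,
    mul_one, koszul_comm (p j) (p i)]
  rcases lt_or_gt_of_ne h1 with h3 | h3 <;> rcases lt_or_gt_of_ne h2 with h4 | h4 <;>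
    simp [h3, h4, not_lt.2 h3.le, not_lt.2 h4.le, hk]

/-- The action of permutations on the tensor space:
`τ (v₁ ⊗ ⋯ ⊗ v_N) = c(p(v), τ) v_{τ⁻¹(1)} ⊗ ⋯ ⊗ v_{τ⁻¹(N)}` for homogeneous `v_i`. -/
def permRep (n N : ℕ) : Equiv.Perm (Fin N) →* Module.End ℂ (Tens n N) where
  toFun τ := (tensBasis n N).constr ℂ fun f =>
    permSign (par ∘ f) τ • tensBasis n N (f ∘ τ.symm)
  map_one' := by
    refine (tensBasis n N).ext fun f => ?_
    rw [Module.Basis.constr_basis, permSign_one, one_smul]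
    rfl
  map_mul' σ τ := by
    refine (tensBasis n N).ext fun f => ?_
    rw [Module.End.mul_apply, Module.Basis.constr_basis, Module.Basis.constr_basis, map_smul,
      Module.Basis.constr_basis, smul_smul, permSign_mul, mul_comm]
    rfl

theorem permRep_basis {n N : ℕ} (τ : Equiv.Perm (Fin N)) (f : Fin N → Idx n) :
    permRep n N τ (tensBasis n N f)
      = permSign (par ∘ f) τ • tensBasis n N (f ∘ τ.symm) :=
  Module.Basis.constr_basis _ _ _ _

/-- The operator `P = (0 1; -1 0)` of `ℂ^{n|n}`. -/
def P (n : ℕ) : Module.End ℂ (Idx n → ℂ) :=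
  Matrix.toLin' (Matrix.fromBlocks 0 1 (-1) 0)

/-- The operator `π(a_k) = 1 ⊗ ⋯ ⊗ P ⊗ ⋯ ⊗ 1`, with the odd operator `P` at the place `k`. -/
def cliffOp (n : ℕ) {N : ℕ} (k : Fin N) : Module.End ℂ (Tens n N) := slot 1 k (P n)

theorem P_sq (n : ℕ) : P n * P n = (-1 : ℂ) • 1 := by
  rw [P, Module.End.mul_eq_comp, ← Matrix.toLin'_mul, Matrix.fromBlocks_multiply]
  have : Matrix.fromBlocks (0 * 0 + 1 * -1) (0 * 1 + 1 * 0) (-1 * 0 + 0 * -1) (-1 * 1 + 0 * 0)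
      = (-1 : Matrix (Idx n) (Idx n) ℂ) := by
    rw [← Matrix.fromBlocks_one, Matrix.fromBlocks_neg]
    simp
  rw [this, map_neg, Matrix.toLin'_one]
  exact (neg_one_smul ℂ (1 : Module.End ℂ (Idx n → ℂ))).symm

theorem hasParity_P (n : ℕ) : HasParity 1 (P n) := by
  rw [HasParity, P, parityOp, Module.End.mul_eq_comp, Module.End.mul_eq_comp,
    ← Matrix.toLin'_mul, ← Matrix.toLin'_mul, ← map_smul]
  congr 1
  ext (i | i) (j | j) <;>
    simp [Matrix.diagonal_mul, Matrix.mul_diagonal, par, zmod2_val_one]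

theorem slot_zero_one (n : ℕ) {N : ℕ} (k : Fin N) : slot (n := n) 0 k 1 = 1 := by
  rw [slot_apply]
  convert PiTensorProduct.map_one (R := ℂ) (s := fun _ : Fin N => (Idx n → ℂ)) using 2
  funext s
  by_cases h : s = k
  · subst h; simp
  · simp [h]

theorem cliffOp_sq (n : ℕ) {N : ℕ} (k : Fin N) : cliffOp n k * cliffOp n k = (-1 : ℂ) • 1 := by
  rw [cliffOp, slot_mul_same, P_sq, two_zmod2, ← slot_zero_one n k, ← map_smul]

theorem cliffOp_comm (n : ℕ) {N : ℕ} {k l : Fin N} (h : k ≠ l) :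
    cliffOp n k * cliffOp n l = (-1 : ℂ) • (cliffOp n l * cliffOp n k) := by
  rw [cliffOp, cliffOp, slot_comm h (hasParity_P n) (hasParity_P n), koszul_one_one]

theorem P_basis (n : ℕ) (i : Idx n) : P n (Pi.basisFun ℂ (Idx n) i)
    = (-1 : ℂ) ^ (par i + 1).val • Pi.basisFun ℂ (Idx n) i.swap := by
  rw [Pi.basisFun_apply, Pi.basisFun_apply, P, Matrix.toLin'_apply, Matrix.mulVec_single_one]
  ext j
  rcases i with i | i <;> rcases j with j | j <;>
    simp [par, Matrix.one_apply, Pi.single_apply, zmod2_val_one, apply_ite]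

theorem parityOp_basis (n : ℕ) (i : Idx n) : parityOp n (Pi.basisFun ℂ (Idx n) i)
    = koszul 1 (par i) • Pi.basisFun ℂ (Idx n) i := by
  rw [Pi.basisFun_apply, parityOp, Matrix.toLin'_apply]
  ext j
  rcases i with i | i <;> rcases j with j | j <;>
    simp [par, Pi.single_apply, zmod2_val_one]

theorem cliffOp_basis (n : ℕ) {N : ℕ} (k : Fin N) (f : Fin N → Idx n) :
    cliffOp n k (tensBasis n N f)
      = ((-1 : ℂ) ^ (par (f k) + 1).val * ∏ s, if s < k then koszul 1 (par (f s)) else 1) •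
        tensBasis n N (Function.update f k (f k).swap) := by
  have h : (fun s => (Function.update (fun s : Fin N => if s < k then
        parityOp n ^ (1 : ZMod 2).val else 1) k (P n) s) (Pi.basisFun ℂ (Idx n) (f s)))
      = fun s => ((if s = k then (-1 : ℂ) ^ (par (f k) + 1).val else 1) *
          (if s < k then koszul 1 (par (f s)) else 1)) •
          Pi.basisFun ℂ (Idx n) (Function.update f k (f k).swap s) := by
    funext s
    by_cases hs : s = k
    · subst hs
      simp only [Function.update_self, P_basis, lt_irrefl, if_true, if_false, mul_one]
    · by_cases hs' : s < k
      · simp only [Function.update_of_ne hs, hs, hs', if_true, if_false, zmod2_val_one, pow_one,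
          parityOp_basis, one_mul]
      · simp only [Function.update_of_ne hs, hs, hs', if_false, one_mul, one_smul,
          Module.End.one_apply]
  rw [cliffOp, slot_apply, tensBasis, Basis.piTensorProduct_apply, PiTensorProduct.map_tprod, h,
    MultilinearMap.map_smul_univ, Basis.piTensorProduct_apply, Finset.prod_mul_distrib,
    Finset.prod_ite_eq' Finset.univ k, if_pos (Finset.mem_univ k)]

theorem permSign_update {N : ℕ} (p : Fin N → ZMod 2) (k : Fin N) (τ : Equiv.Perm (Fin N)) :
    (∏ s, if s < k then koszul 1 (p s) else 1) * permSign (Function.update p k (p k + 1)) τ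
      = permSign p τ * ∏ s, if τ s < τ k then koszul 1 (p s) else 1 := by
  have h : permSign (Function.update p k (p k + 1)) τ = permSign p τ *
      ((∏ s, if k < s ∧ τ s < τ k then koszul 1 (p s) else 1) *
        ∏ s, if s < k ∧ τ k < τ s then koszul 1 (p s) else 1) := by
    have h1 : (∏ s, if k < s ∧ τ s < τ k then koszul 1 (p s) else 1)
        = ∏ i, ∏ j, if i = k then (if k < j ∧ τ j < τ k then koszul 1 (p j) else 1) else 1 := by
      rw [Finset.prod_comm]
      simp
    have h2 : (∏ s, if s < k ∧ τ k < τ s then koszul 1 (p s) else 1)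
        = ∏ i, ∏ j, if j = k then (if i < k ∧ τ k < τ i then koszul 1 (p i) else 1) else 1 := by
      simp
    rw [h1, h2, permSign, permSign]
    simp only [← Finset.prod_mul_distrib]
    refine Finset.prod_congr rfl fun i _ => Finset.prod_congr rfl fun j _ => ?_
    by_cases hi : i = k
    · subst hi
      by_cases hj : j = i
      · subst hj; simp
      · by_cases hc : i < j ∧ τ j < τ i
        · simp [hc, hj, koszul_comm _ (p j), koszul_add_right]
        · simp [hc, hj]
    · by_cases hj : j = k
      · subst hj
        by_cases hc : i < j ∧ τ j < τ i
        · simp [hc, hi, koszul_comm 1, koszul_add_right]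
        · simp [hc, hi]
      · simp [hi, hj]
  rw [h, mul_left_comm]
  congr 1
  simp only [← Finset.prod_mul_distrib]
  refine Finset.prod_congr rfl fun s _ => ?_
  rcases lt_trichotomy s k with hs | hs | hs
  · have h1 : τ s ≠ τ k := fun e => hs.ne (τ.injective e)
    rcases lt_or_gt_of_ne h1 with h2 | h2 <;>
      simp [hs, not_lt.2 hs.le, h2, not_lt.2 h2.le, koszul_sq]
  · subst hs; simp
  · simp [hs, not_lt.2 hs.le]

/-- Permutations permute the operators `π(a_k)`. -/
theorem permRep_cliffOp {n N : ℕ} (τ : Equiv.Perm (Fin N)) (k : Fin N) :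
    permRep n N τ * cliffOp n k = cliffOp n (τ k) * permRep n N τ := by
  refine (tensBasis n N).ext fun f => ?_
  have h1 : par ∘ Function.update f k (f k).swap
      = Function.update (par ∘ f) k ((par ∘ f) k + 1) := by
    rw [Function.comp_update, par_swap]
    rfl
  have h2 : Function.update f k (f k).swap ∘ τ.symm
      = Function.update (f ∘ τ.symm) (τ k) ((f ∘ τ.symm) (τ k)).swap := by
    funext s
    by_cases hs : s = τ k
    · subst hs; simp
    · have : τ.symm s ≠ k := fun e => hs (by rw [← e, Equiv.apply_symm_apply])
      simp [hs, this]
  have h3 : (∏ s, if s < τ k then koszul 1 (par ((f ∘ τ.symm) s)) else 1)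
      = ∏ s, if τ s < τ k then koszul 1 ((par ∘ f) s) else 1 := by
    rw [← Equiv.prod_comp τ]
    simp
  rw [Module.End.mul_apply, Module.End.mul_apply, cliffOp_basis, map_smul, permRep_basis,
    permRep_basis, map_smul, cliffOp_basis, smul_smul, smul_smul, h1, h2, h3, mul_assoc,
    mul_left_comm (permSign _ _), ← permSign_update]
  simp

end Tensor

section Sergeev

/-- The relations of the group `H_N`. Its generators are `ε = none` and `a_p = some p`. -/
def cliffRels (N : ℕ) : Set (FreeGroup (Option (Fin N))) :=
  {r | (∃ p : Fin N, r = .of (some p) ^ 2 * (.of none)⁻¹) ∨ r = .of none ^ 2 ∨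
    ∃ p q : Fin N, p ≠ q ∧
      r = .of (some p) * .of (some q) * (.of none * .of (some q) * .of (some p))⁻¹}

/-- The group `H_N` generated by `a₁, …, a_N, ε` subject to the relations `a_p² = ε`, `ε² = 1` and
`a_p a_q = ε a_q a_p` for `p ≠ q`. -/
abbrev CliffGroup (N : ℕ) : Type := PresentedGroup (cliffRels N)

/-- The universal property of `H_N`. -/
def CliffGroup.lift {N : ℕ} {G : Type*} [Group G] (e : G) (a : Fin N → G)
    (h1 : ∀ p, a p ^ 2 = e) (h2 : e ^ 2 = 1) (h3 : ∀ p q, p ≠ q → a p * a q = e * a q * a p) :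
    CliffGroup N →* G :=
  PresentedGroup.toGroup (f := fun x => x.elim e a) (by
    rintro _ (⟨p, rfl⟩ | rfl | ⟨p, q, hpq, rfl⟩)
    · simp [h1]
    · simp [h2]
    · simp [h3 p q hpq])

/-- The generator `ε`. -/
def CliffGroup.eps (N : ℕ) : CliffGroup N := PresentedGroup.of none

/-- The generators `a_p`. -/
def CliffGroup.a {N : ℕ} (p : Fin N) : CliffGroup N := PresentedGroup.of (some p)

theorem CliffGroup.a_sq {N : ℕ} (p : Fin N) : a p ^ 2 = eps N :=
  mul_inv_eq_one.1 (PresentedGroup.one_of_mem (rels := cliffRels N) (Or.inl ⟨p, rfl⟩))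

theorem CliffGroup.eps_sq (N : ℕ) : eps N ^ 2 = 1 :=
  PresentedGroup.one_of_mem (rels := cliffRels N) (Or.inr (Or.inl rfl))

theorem CliffGroup.a_mul_a {N : ℕ} {p q : Fin N} (h : p ≠ q) : a p * a q = eps N * a q * a p :=
  mul_inv_eq_one.1
    (PresentedGroup.one_of_mem (rels := cliffRels N) (Or.inr (Or.inr ⟨p, q, h, rfl⟩)))

theorem CliffGroup.hom_ext {N : ℕ} {G : Type*} [Group G] {f g : CliffGroup N →* G}
    (h1 : f (eps N) = g (eps N)) (h2 : ∀ p, f (a p) = g (a p)) : f = g := by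
  refine PresentedGroup.ext fun x => ?_
  rcases x with _ | p
  · exact h1
  · exact h2 p

@[simp] theorem CliffGroup.lift_eps {N : ℕ} {G : Type*} [Group G] (e : G) (a' : Fin N → G)
    (h1 h2 h3) : CliffGroup.lift e a' h1 h2 h3 (eps N) = e :=
  PresentedGroup.toGroup.of _

@[simp] theorem CliffGroup.lift_a {N : ℕ} {G : Type*} [Group G] (e : G) (a' : Fin N → G)
    (h1 h2 h3) (p : Fin N) : CliffGroup.lift e a' h1 h2 h3 (a p) = a' p :=
  PresentedGroup.toGroup.of _

/-- The endomorphism `ε ↦ ε`, `a_p ↦ a_{τ(p)}` of `H_N`. -/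
def CliffGroup.permHom {N : ℕ} (τ : Equiv.Perm (Fin N)) : CliffGroup N →* CliffGroup N :=
  CliffGroup.lift (eps N) (fun p => a (τ p)) (fun _ => a_sq _) (eps_sq N)
    fun _ _ h => a_mul_a fun e => h (τ.injective e)

/-- The action of `S_N` on `H_N` by automorphisms: `τ(ε) = ε`, `τ(a_p) = a_{τ(p)}`. -/
def CliffGroup.permAut (N : ℕ) : Equiv.Perm (Fin N) →* MulAut (CliffGroup N) where
  toFun τ := MonoidHom.toMulEquiv (permHom τ) (permHom τ⁻¹)
    (hom_ext (by simp [permHom]) (by simp [permHom]))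
    (hom_ext (by simp [permHom]) (by simp [permHom]))
  map_one' := MulEquiv.toMonoidHom_injective
    (hom_ext (by simp [permHom]) (by simp [permHom]))
  map_mul' σ τ := MulEquiv.toMonoidHom_injective
    (hom_ext (by simp [permHom]) (by simp [permHom]))

theorem CliffGroup.permAut_eps {N : ℕ} (τ : Equiv.Perm (Fin N)) :
    permAut N τ (eps N) = eps N := by
  simp [permAut, permHom]

theorem CliffGroup.permAut_a {N : ℕ} (τ : Equiv.Perm (Fin N)) (p : Fin N) :
    permAut N τ (a p) = a (τ p) := by
  simp [permAut, permHom]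

/-- The Sergeev group `Se(N) = H_N ⋊ S_N`. -/
abbrev Se (N : ℕ) : Type := CliffGroup N ⋊[CliffGroup.permAut N] Equiv.Perm (Fin N)

/-- The operator `π(a_k)` as a unit. -/
def cliffUnit (n : ℕ) {N : ℕ} (k : Fin N) : (Module.End ℂ (Tens n N))ˣ where
  val := cliffOp n k
  inv := (-1 : ℂ) • cliffOp n k
  val_inv := by rw [mul_smul_comm, cliffOp_sq, smul_smul, neg_mul_neg, one_mul, one_smul]
  inv_val := by rw [smul_mul_assoc, cliffOp_sq, smul_smul, neg_mul_neg, one_mul, one_smul]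

/-- The operator `π(ε) = -Id` as a unit. -/
def epsUnit (n N : ℕ) : (Module.End ℂ (Tens n N))ˣ where
  val := (-1 : ℂ) • 1
  inv := (-1 : ℂ) • 1
  val_inv := by rw [mul_smul_comm, mul_one, smul_smul, neg_mul_neg, one_mul, one_smul]
  inv_val := by rw [mul_smul_comm, mul_one, smul_smul, neg_mul_neg, one_mul, one_smul]

/-- The representation of `H_N` in the tensor space: `π(ε) = -Id` and
`π(a_k) = 1 ⊗ ⋯ ⊗ P ⊗ ⋯ ⊗ 1`. -/
def cliffRep (n N : ℕ) : CliffGroup N →* (Module.End ℂ (Tens n N))ˣ :=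
  CliffGroup.lift (epsUnit n N) (cliffUnit n)
    (fun p => Units.ext ((pow_two _).trans (cliffOp_sq n p)))
    ((pow_two _).trans (Units.ext (epsUnit n N).val_inv))
    (fun p q h => Units.ext ((cliffOp_comm n h).trans (by
      rw [mul_assoc, Units.val_mul, Units.val_mul]
      change _ = ((-1 : ℂ) • 1) * (cliffOp n q * cliffOp n p)
      rw [smul_mul_assoc, one_mul])))

/-- The representation `π` of `Se(N)` in the tensor space. -/
def sergeevRep (n N : ℕ) : Representation ℂ (Se N) (Tens n N) :=
  (Units.coeHom _).comp (SemidirectProduct.lift (cliffRep n N) (permRep n N).toHomUnits (by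
    intro τ
    refine CliffGroup.hom_ext ?_ fun p => ?_
    · simp only [MonoidHom.comp_apply, MulEquiv.coe_toMonoidHom, CliffGroup.permAut_eps,
        MulAut.conj_apply, cliffRep, CliffGroup.lift_eps]
      rw [eq_mul_inv_iff_mul_eq]
      refine Units.ext ?_
      change ((-1 : ℂ) • 1) * permRep n N τ = permRep n N τ * ((-1 : ℂ) • 1)
      rw [smul_mul_assoc, one_mul, mul_smul_comm, mul_one]
    · simp only [MonoidHom.comp_apply, MulEquiv.coe_toMonoidHom, CliffGroup.permAut_a,
        MulAut.conj_apply, cliffRep, CliffGroup.lift_a]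
      rw [eq_mul_inv_iff_mul_eq]
      exact Units.ext (permRep_cliffOp τ p).symm))

/-- The ordered product `a_{α₁} ⋯ a_{α_s}` for a subset `α = {α₁ < ⋯ < α_s}`. -/
def aProd {N : ℕ} (α : Finset (Fin N)) : Se N :=
  SemidirectProduct.inl ((α.sort (· ≤ ·)).map CliffGroup.a).prod

/-- The places `(j, t)` of a sequence `(i₁, …, i_k)` cut into consecutive blocks of lengths
`ρ₁, …, ρ_l`: the place `t` in the block `j`. -/
abbrev Places (ρ : List ℕ) : Type := Σ j : Fin ρ.length, Fin (ρ.get j)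

/-- For a sequence `i` of pairwise distinct elements of `{1, …, N}`, cut into blocks of lengths
`ρ₁, …, ρ_l`, the product of cycles `(i₁, …, i_{ρ₁}) (i_{ρ₁+1}, …, i_{ρ₁+ρ₂}) ⋯`. -/
def blockCycles {N : ℕ} (ρ : List ℕ) (i : Places ρ ↪ Fin N) : Equiv.Perm (Fin N) :=
  Equiv.Perm.viaFintypeEmbedding (Equiv.sigmaCongrRight fun j => finRotate (ρ.get j)) i

/-- The element `q_{ρ,N}` of `ℂ[Se(N)]`: the sum over all sequences `i` of pairwise distinct elements
of `{1, …, N}` and all subsets `α` of `{i₁, …, i_k}` of the conjugates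
`(a_{α₁} ⋯ a_{α_s}) (i₁, …, i_{ρ₁}) ⋯ (…, i_k) (a_{α₁} ⋯ a_{α_s})⁻¹`. -/
def qElem (N : ℕ) (ρ : List ℕ) : MonoidAlgebra ℂ (Se N) :=
  ∑ i : Places ρ ↪ Fin N, ∑ α ∈ (Finset.univ.map i).powerset,
    MonoidAlgebra.of ℂ (Se N)
      (aProd α * SemidirectProduct.inr (blockCycles ρ i) * (aProd α)⁻¹)

/-- The parts `ρ₁ ≥ ρ₂ ≥ ⋯ ≥ ρ_l` of a partition. -/
def partsList {k : ℕ} (ρ : Nat.Partition k) : List ℕ := ρ.parts.sort (· ≥ ·)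

end Sergeev

end SuperDuality

end

/-! Both elements are shown to act as one explicit sum: over injective sequences of places `s` and
over index sequences, of the sign occurring in `J` times the product of the operators `F` in the
places `s`.

On the enveloping side, `σ(u * X) = σ(u) X`, and `X` acts by the sum over all places `t` of `X` put
in `t`. If `σ(Y₁ ⋯ Y_k)` acts by `Y₁, …, Y_k` in distinct places, then multiplying by `X` either
uses a new place or hits the place of some `Y_r`, producing `⟨Y_r X⟩` there with the Koszul sign of
moving `X` past the later factors. The second kind is exactly the correction terms of `*`. Hence, by
induction, `σ(Y₁ ⋯ Y_{k+1})` again acts by its factors in distinct places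
(`gammaRep_specialSymm_ofFn`).

On the Sergeev side, a transposition acts by the signed sum of `E_{ab} ⊗ E_{ba}` (`permRep_swap`),
so a cycle acts by the signed cyclic sum of `E_{i₁i₂} ⊗ ⋯ ⊗ E_{i_ki₁}` (`permRep_cycle`).
Conjugation by `a_t` replaces the unit `E_{ij}` at the place `t` by `E_{δ(i)δ(j)}`; the signs cancel
because a cyclic word in matrix units is even. Summing over all subsets `α` of the places therefore
turns each `E_{ij}` into `E_{ij} + E_{δ(i)δ(j)} = F_{ij}` (`sum_conjRep_prod_slot`).

Centrality is a symmetry of the defining sum: conjugation by a permutation relabels the pairs `(i,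
α)`, and conjugation by `a_p` toggles `p` in `α` when `p` is among the `i_t` and fixes every summand
otherwise. Throughout, `ε` is invisible to conjugation, so the `a_p` may be treated as commuting
involutions. -/

open scoped TensorProduct

noncomputable section

namespace SuperDuality


/-! ### Matrix units in single places, and the operator of a transposition. -/

section TensorOperators

variable {n N : ℕ}

/-- The matrix unit `E_{ij}` as an operator of `ℂ^{n|n}`. -/
def unitOp {n : ℕ} (i j : Idx n) : Module.End ℂ (Idx n → ℂ) := Matrix.toLin' (Matrix.single i j 1)

theorem unitOp_basis (a b i : Idx n) : unitOp a b (Pi.basisFun ℂ (Idx n) i)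
    = if i = b then Pi.basisFun ℂ (Idx n) a else 0 := by
  rw [Pi.basisFun_apply, unitOp, Matrix.toLin'_apply, Matrix.mulVec_single_one]
  ext j
  by_cases h : i = b
  · subst h
    simp [Matrix.single_apply, Pi.single_apply, eq_comm]
  · simp [h, Ne.symm h]

theorem unitOp_mul (a b c d : Idx n) :
    unitOp a b * unitOp c d = if b = c then unitOp a d else 0 := by
  rw [unitOp, unitOp, Module.End.mul_eq_comp, ← Matrix.toLin'_mul]
  split_ifs with h
  · subst h; simp [unitOp]
  · simp [h]

theorem hasParity_unitOp (i j : Idx n) : HasParity (par i + par j) (unitOp i j) := by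
  refine (Pi.basisFun ℂ (Idx n)).ext fun k => ?_
  rw [LinearMap.smul_apply, Module.End.mul_apply, Module.End.mul_apply, unitOp_basis,
    parityOp_basis, map_smul, unitOp_basis]
  split_ifs with h
  · subst h
    rw [parityOp_basis, smul_smul, koszul_add_right, mul_assoc, koszul_sq, mul_one]
  · simp

/-- The local source of `F`: conjugation by `P` applies `δ` to both indices, and the sign is the one
for an odd operator passing `E_{ij}`. It is this sign that lets `cliffOp_mul_prod_slot` treat all
places uniformly. -/
theorem P_mul_unitOp (i j : Idx n) :
    P n * unitOp i j = koszul 1 (par i + par j) • (unitOp i.swap j.swap * P n) := by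
  refine (Pi.basisFun ℂ (Idx n)).ext fun k => ?_
  rw [LinearMap.smul_apply, Module.End.mul_apply, Module.End.mul_apply, unitOp_basis,
    P_basis, map_smul, unitOp_basis]
  by_cases h : k = j
  · subst h
    rw [if_pos rfl, if_pos rfl, P_basis, smul_smul]
    congr 1
    rcases i with i | i <;> rcases k with k | k <;> simp [par]
  · rw [if_neg h, if_neg fun e => h (by simpa using congrArg Sum.swap e)]
    simp

theorem sum_unitOp_self : ∑ i : Idx n, unitOp i i = 1 := by
  refine (Pi.basisFun ℂ (Idx n)).ext fun k => ?_
  simp only [LinearMap.sum_apply, unitOp_basis, Module.End.one_apply]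
  simp

theorem vecRep_F (i j : Idx n) : vecRep n (F i j) = unitOp i j + unitOp i.swap j.swap :=
  map_add (Matrix.toLin' (R := ℂ) (m := Idx n) (n := Idx n)) _ _

theorem F_mem_Qgr (i j : Idx n) : F i j ∈ Qgr n (par i + par j) := by
  intro k l h
  change (Matrix.single i j 1 + Matrix.single i.swap j.swap 1 : Matrix (Idx n) (Idx n) ℂ) k l = 0
  have h1 : ¬ (i = k ∧ j = l) := by rintro ⟨rfl, rfl⟩; exact h rfl
  have h2 : ¬ (i.swap = k ∧ j.swap = l) := by
    rintro ⟨rfl, rfl⟩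
    apply h
    rw [par_swap, par_swap, add_add_add_comm, two_zmod2, add_zero]
  rw [Matrix.add_apply, Matrix.single_apply, Matrix.single_apply, if_neg h1, if_neg h2, add_zero]

theorem slot_unitOp_basis (d : ZMod 2) (u : Fin N) (a b : Idx n) (f : Fin N → Idx n) :
    slot d u (unitOp a b) (tensBasis n N f)
      = if f u = b then (∏ r, if r < u then koszul d (par (f r)) else 1) •
          tensBasis n N (Function.update f u a) else 0 := by
  have hpow (i : Idx n) : (parityOp n ^ d.val) (Pi.basisFun ℂ (Idx n) i)
      = koszul d (par i) • Pi.basisFun ℂ (Idx n) i := by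
    rcases zmod2_cases d with rfl | rfl
    · simp
    · rw [zmod2_val_one, pow_one, parityOp_basis]
  -- The condition `f u = b` is recorded as a scalar 0 or 1 at the place `u`, so that multilinearity
  -- extracts it together with all the Koszul signs.
  have h : (fun s => (Function.update (fun s : Fin N => if s < u then
        parityOp n ^ d.val else 1) u (unitOp a b) s) (Pi.basisFun ℂ (Idx n) (f s)))
      = fun s => ((if s = u then (if f u = b then 1 else 0 : ℂ) else 1) *
          (if s < u then koszul d (par (f s)) else 1)) •
          Pi.basisFun ℂ (Idx n) (Function.update f u a s) := by
    funext s
    by_cases hs : s = u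
    · subst hs
      simp only [Function.update_self, unitOp_basis, lt_irrefl, if_true, if_false, mul_one]
      split_ifs <;> simp
    · by_cases hs' : s < u
      · simp only [Function.update_of_ne hs, hs, hs', if_true, if_false, hpow, one_mul]
      · simp only [Function.update_of_ne hs, hs, hs', if_false, one_mul, one_smul,
          Module.End.one_apply]
  rw [slot_apply, tensBasis, Basis.piTensorProduct_apply, PiTensorProduct.map_tprod, h,
    MultilinearMap.map_smul_univ, Basis.piTensorProduct_apply, Finset.prod_mul_distrib,
    Finset.prod_ite_eq' Finset.univ u, if_pos (Finset.mem_univ u)]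
  split_ifs <;> simp

/-- The inversions of the transposition are the pair `(s, t)` and, for each `r` strictly between,
the pairs `(s, r)` and `(r, t)`. Each group is written as a double product over `(i, j)`, so that
the comparison is made factor by factor. -/
theorem permSign_swap {s t : Fin N} (hst : s < t) (p : Fin N → ZMod 2) :
    permSign p (Equiv.swap s t)
      = koszul (p s) (p t) * ∏ r, if s < r ∧ r < t then koszul (p s + p t) (p r) else 1 := by
  have h1 : koszul (p s) (p t)
      = ∏ i, ∏ j, if i = s then (if j = t then koszul (p s) (p t) else 1) else 1 := by
    rw [Finset.prod_comm]
    simp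
  have h2 : (∏ r, if s < r ∧ r < t then koszul (p s + p t) (p r) else 1)
      = (∏ i, ∏ j, if i = s then (if s < j ∧ j < t then koszul (p s) (p j) else 1) else 1)
        * ∏ i, ∏ j, if j = t then (if s < i ∧ i < t then koszul (p i) (p t) else 1) else 1 := by
    rw [Finset.prod_comm (f := fun i j =>
      if i = s then (if s < j ∧ j < t then koszul (p s) (p j) else 1) else 1)]
    simp only [Finset.prod_ite_eq', Finset.mem_univ, if_true]
    rw [← Finset.prod_mul_distrib]
    refine Finset.prod_congr rfl fun r _ => ?_
    split_ifs
    · rw [koszul_comm, koszul_add_right, koszul_comm (p r) (p s)]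
    · rw [mul_one]
  rw [h1, h2, permSign]
  simp only [← Finset.prod_mul_distrib]
  refine Finset.prod_congr rfl fun i _ => Finset.prod_congr rfl fun j _ => ?_
  by_cases his : i = s
  · subst his
    by_cases hjt : j = t
    · subst hjt; simp [hst]
    · by_cases hji : j = i
      · subst hji; simp [hst.ne]
      · simp [Equiv.swap_apply_of_ne_of_ne hji hjt, hjt]
  · by_cases hit : i = t
    · subst hit
      by_cases hjs : j = s
      · subst hjs; simp [his, hst.ne, not_lt.2 hst.le]
      · by_cases hji : j = i
        · subst hji; simp [his]
        · have : ¬ (i < j ∧ j < s) := fun h => absurd (hst.trans h.1) (not_lt.2 h.2.le)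
          simp [his, hji, Equiv.swap_apply_of_ne_of_ne hjs hji, this]
    · by_cases hjt : j = t
      · subst hjt
        simp [his, Equiv.swap_apply_of_ne_of_ne his hit, and_comm]
      · by_cases hjs : j = s
        · subst hjs
          have : ¬ (i < j ∧ t < i) := fun h => absurd (hst.trans h.2) (not_lt.2 h.1.le)
          simp [his, Equiv.swap_apply_of_ne_of_ne his hit, this, hjt]
        · have : ¬ (i < j ∧ j < i) := fun h => absurd h.1 (not_lt.2 h.2.le)
          simp [his, Equiv.swap_apply_of_ne_of_ne his hit, Equiv.swap_apply_of_ne_of_ne hjs hjt,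
            hjt, this]

/-- A transposition acts as `∑_{a,b} (-1)^{p(b)} E_{ab} ⊗ E_{ba}` in the two places. -/
theorem permRep_swap {s t : Fin N} (hst : s ≠ t) :
    permRep n N (Equiv.swap s t) = ∑ a : Idx n, ∑ b : Idx n, (-1 : ℂ) ^ (par b).val •
      (slot (par a + par b) s (unitOp a b) * slot (par b + par a) t (unitOp b a)) := by
  -- Exchanging the two places costs `(-1)^{p(a) + p(b)}`, which turns the sign `(-1)^{p(b)}` into
  -- `(-1)^{p(a)}`; this is the same sum with `a` and `b` renamed.
  wlog h : s < t generalizing s t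
  · rw [Equiv.swap_comm, this hst.symm (lt_of_le_of_ne (not_lt.1 h) hst.symm), Finset.sum_comm]
    refine Finset.sum_congr rfl fun a _ => Finset.sum_congr rfl fun b _ => ?_
    rw [slot_comm hst.symm (hasParity_unitOp b a) (hasParity_unitOp a b), smul_smul]
    congr 1
    rcases a with a | a <;> rcases b with b | b <;> simp [par]
  refine (tensBasis n N).ext fun f => ?_
  simp only [LinearMap.sum_apply, LinearMap.smul_apply, Module.End.mul_apply, slot_unitOp_basis]
  -- On a basis vector only the term `a = f t`, `b = f s` survives.
  rw [Finset.sum_eq_single (f t), Finset.sum_eq_single (f s)]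
  · rw [if_pos rfl, map_smul, slot_unitOp_basis, Function.update_of_ne hst, if_pos rfl,
      permRep_basis, smul_smul, smul_smul, permSign_swap h]
    congr 1
    · have h3 : (∏ r, if r < s then koszul (par (f t) + par (f s))
            (par (Function.update f t (f s) r)) else 1)
          = ∏ r, if r < s then koszul (par (f s) + par (f t)) (par (f r)) else 1 := by
        refine Finset.prod_congr rfl fun r _ => ?_
        split_ifs with hr
        · rw [Function.update_of_ne (hr.trans h).ne, add_comm]
        · rfl
      -- The places before `s` are crossed by both operators and cancel (`h6`), those between `s`
      -- and `t` give the product in `permSign_swap`, and the place `s` itself combines with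
      -- `(-1)^{p(b)}` to give the sign of the pair `(s, t)` (`h7`).
      have h4 : (∏ r, if r < t then koszul (par (f s) + par (f t)) (par (f r)) else 1)
          = (∏ r, if r < s then koszul (par (f s) + par (f t)) (par (f r)) else 1)
            * (∏ r, if s < r ∧ r < t then koszul (par (f s) + par (f t)) (par (f r)) else 1)
            * koszul (par (f s) + par (f t)) (par (f s)) := by
        have h5 : koszul (par (f s) + par (f t)) (par (f s))
            = ∏ r, if r = s then koszul (par (f s) + par (f t)) (par (f r)) else 1 := by simp
        rw [h5]
        simp only [← Finset.prod_mul_distrib]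
        refine Finset.prod_congr rfl fun r _ => ?_
        rcases lt_trichotomy r s with hr | hr | hr
        · simp [hr, hr.trans h, hr.ne, not_lt.2 hr.le]
        · subst hr; simp [h]
        · simp [hr, hr.ne', not_lt.2 hr.le]
      have h6 : (∏ r, if r < s then koszul (par (f s) + par (f t)) (par (f r)) else 1)
          * (∏ r, if r < s then koszul (par (f s) + par (f t)) (par (f r)) else 1) = 1 := by
        rw [← Finset.prod_mul_distrib]
        refine Finset.prod_eq_one fun r _ => ?_
        split_ifs
        · exact koszul_sq _ _
        · exact mul_one 1
      have h7 : koszul (par (f s)) (par (f t))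
          = (-1) ^ (par (f s)).val * koszul (par (f s) + par (f t)) (par (f s)) := by
        generalize f s = a, f t = b
        rcases a with a | a <;> rcases b with b | b <;> simp [par]
      simp only [Function.comp_apply]
      rw [h3, h4, h7]
      linear_combination (-((-1) ^ (par (f s)).val * koszul (par (f s) + par (f t)) (par (f s))
        * ∏ r, if s < r ∧ r < t then koszul (par (f s) + par (f t)) (par (f r)) else 1)) * h6
    · congr 1
      funext r
      rw [Equiv.symm_swap, Function.comp_apply]
      by_cases hr : r = s
      · subst hr; simp
      · by_cases hr' : r = t
        · subst hr'; simp [hr]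
        · simp [hr, hr', Equiv.swap_apply_of_ne_of_ne hr hr']
  · intro b _ hb
    rw [if_pos rfl, map_smul, slot_unitOp_basis, Function.update_of_ne hst, if_neg hb.symm]
    simp
  · simp
  · intro a _ ha
    refine Finset.sum_eq_zero fun b _ => ?_
    rw [if_neg ha.symm]
    simp
  · simp

end TensorOperators


/-! ### Conjugation in the Sergeev group and centrality of `q_{ρ,N}`. -/

section SergeevGroup

variable {N : ℕ}

theorem map_aProd {G : Type*} [Monoid G] (φ : Se N →* G) (α : Finset (Fin N)) :
    φ (aProd α) = ((α.sort (· ≤ ·)).map fun p =>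
      φ (SemidirectProduct.inl (CliffGroup.a p))).prod := by
  rw [aProd, map_list_prod, map_list_prod, List.map_map, List.map_map]
  rfl

/-- Sorting in `aProd` matters only up to powers of `ε`. For a homomorphism under which the images
of the `a_p` commute, such as conjugation, any listing of the set gives the same product. -/
theorem map_aProd_of_nodup {G : Type*} [Monoid G] (φ : Se N →* G)
    (h : ∀ p q, Commute (φ (SemidirectProduct.inl (CliffGroup.a p)))
      (φ (SemidirectProduct.inl (CliffGroup.a q))))
    {l : List (Fin N)} (hl : l.Nodup) :
    φ (aProd l.toFinset) = (l.map fun p => φ (SemidirectProduct.inl (CliffGroup.a p))).prod := by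
  rw [map_aProd]
  refine List.Perm.prod_eq' (List.Perm.map _ ?_) ?_
  · exact List.perm_of_nodup_nodup_toFinset_eq (Finset.sort_nodup _ _) hl
      (Finset.sort_toFinset _ _)
  · rw [List.pairwise_map]
    exact List.pairwise_of_forall fun p q => h p q

theorem map_aProd_insert {G : Type*} [Monoid G] (φ : Se N →* G)
    (h : ∀ p q, Commute (φ (SemidirectProduct.inl (CliffGroup.a p)))
      (φ (SemidirectProduct.inl (CliffGroup.a q))))
    {t : Fin N} {α : Finset (Fin N)} (ht : t ∉ α) :
    φ (aProd (insert t α)) = φ (SemidirectProduct.inl (CliffGroup.a t)) * φ (aProd α) := by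
  have h1 : (t :: α.sort (· ≤ ·)).Nodup :=
    List.nodup_cons.2 ⟨by simpa using ht, Finset.sort_nodup _ _⟩
  have h2 : (t :: α.sort (· ≤ ·)).toFinset = insert t α := by
    rw [List.toFinset_cons, Finset.sort_toFinset]
  rw [← h2, map_aProd_of_nodup φ h h1, List.map_cons, List.prod_cons, map_aProd]

/-- Since `ε = a_p²`, it commutes with every `a_p`, and the centralizer is a subgroup containing all
generators. -/
theorem CliffGroup.eps_mul (h : CliffGroup N) : eps N * h = h * eps N := by
  have key : h ∈ Subgroup.centralizer {eps N} := by
    have : Subgroup.closure (Set.range (PresentedGroup.of (rels := cliffRels N)))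
        ≤ Subgroup.centralizer {eps N} := by
      rw [Subgroup.closure_le]
      rintro _ ⟨x, rfl⟩
      rw [SetLike.mem_coe, Subgroup.mem_centralizer_iff]
      rintro _ rfl
      rcases x with _ | p
      · rfl
      · change eps N * a p = a p * eps N
        rw [← a_sq p, pow_two, mul_assoc]
    rw [PresentedGroup.closure_range_of] at this
    exact this (Subgroup.mem_top h)
  exact Subgroup.mem_centralizer_iff.1 key _ rfl

/-- `ε` is central in `Se(N)`. -/
theorem conj_eps : MulAut.conj (SemidirectProduct.inl (CliffGroup.eps N) : Se N) = 1 := by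
  ext1 x
  rw [MulAut.conj_apply, MulAut.one_apply, mul_inv_eq_iff_eq_mul]
  refine SemidirectProduct.ext ?_ ?_
  · simp [CliffGroup.permAut_eps, CliffGroup.eps_mul]
  · simp

/-- The factor `ε` in `a_p a_q = ε a_q a_p` is central, so it disappears under conjugation. -/
theorem commute_conj_a (p q : Fin N) :
    Commute (MulAut.conj (SemidirectProduct.inl (CliffGroup.a p) : Se N))
      (MulAut.conj (SemidirectProduct.inl (CliffGroup.a q))) := by
  by_cases h : p = q
  · subst h; exact Commute.refl _
  · rw [commute_iff_eq, ← map_mul, ← map_mul, CliffGroup.a_mul_a h, mul_assoc, map_mul, map_mul,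
      conj_eps, one_mul, map_mul, map_mul]

theorem conj_a_mul_self (p : Fin N) :
    MulAut.conj (SemidirectProduct.inl (CliffGroup.a p) : Se N)
      * MulAut.conj (SemidirectProduct.inl (CliffGroup.a p)) = 1 := by
  rw [← map_mul, ← map_mul, ← pow_two, CliffGroup.a_sq, conj_eps]

theorem inr_mul_inl_a (σ : Equiv.Perm (Fin N)) (p : Fin N) :
    (SemidirectProduct.inr σ * SemidirectProduct.inl (CliffGroup.a p) : Se N)
      = SemidirectProduct.inl (CliffGroup.a (σ p)) * SemidirectProduct.inr σ := by
  refine SemidirectProduct.ext ?_ ?_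
  · simp [CliffGroup.permAut_a]
  · simp

/-- A permutation carries `a_α` to `a_{σ(α)}` only up to a power of `ε`, since it need not preserve
the order on `α`. The identity is therefore stated for conjugations, where the discrepancy vanishes.
-/
theorem conj_inr_mul_conj_aProd (σ : Equiv.Perm (Fin N)) (α : Finset (Fin N)) :
    MulAut.conj (SemidirectProduct.inr σ : Se N) * MulAut.conj (aProd α)
      = MulAut.conj (aProd (α.map σ.toEmbedding)) * MulAut.conj (SemidirectProduct.inr σ) := by
  induction α using Finset.induction_on with
  | empty => simp [aProd]
  | insert t α ht ih =>
    have ht' : σ t ∉ α.map σ.toEmbedding := by simpa using ht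
    rw [map_aProd_insert _ commute_conj_a ht, Finset.map_insert, Equiv.coe_toEmbedding,
      map_aProd_insert _ commute_conj_a ht', ← mul_assoc, ← map_mul, inr_mul_inl_a, map_mul,
      mul_assoc, ih, mul_assoc]

theorem viaFintypeEmbedding_conj {κ : Type*} [Fintype κ] (e : Equiv.Perm κ) (s : κ ↪ Fin N)
    (σ : Equiv.Perm (Fin N)) :
    σ * e.viaFintypeEmbedding s = e.viaFintypeEmbedding (s.trans σ.toEmbedding) * σ := by
  ext1 x
  rw [Equiv.Perm.mul_apply, Equiv.Perm.mul_apply]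
  by_cases h : x ∈ Set.range s
  · obtain ⟨y, rfl⟩ := h
    have := e.viaFintypeEmbedding_apply_image (s.trans σ.toEmbedding) y
    rw [Function.Embedding.trans_apply, Equiv.coe_toEmbedding] at this
    rw [Equiv.Perm.viaFintypeEmbedding_apply_image, this]
    rfl
  · rw [Equiv.Perm.viaFintypeEmbedding_apply_notMem_range _ _ h,
      Equiv.Perm.viaFintypeEmbedding_apply_notMem_range]
    rintro ⟨y, hy⟩
    exact h ⟨y, σ.injective hy⟩

theorem qElem_eq (ρ : List ℕ) : qElem N ρ
    = ∑ i : Places ρ ↪ Fin N, ∑ α ∈ (Finset.univ.map i).powerset,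
      MonoidAlgebra.of ℂ (Se N)
        (MulAut.conj (aProd α) (SemidirectProduct.inr (blockCycles ρ i))) := rfl

theorem of_mul_of_conj (g x : Se N) : MonoidAlgebra.of ℂ (Se N) g * MonoidAlgebra.of ℂ (Se N) x
    = MonoidAlgebra.of ℂ (Se N) (MulAut.conj g x) * MonoidAlgebra.of ℂ (Se N) g := by
  rw [← map_mul, ← map_mul, MulAut.conj_apply, inv_mul_cancel_right]

/-- Reduces commutation with `g` to invariance of the defining sum under conjugating each summand by
`g`. -/
theorem of_mul_qElem {ρ : List ℕ} {g : Se N}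
    (h : qElem N ρ = ∑ i : Places ρ ↪ Fin N, ∑ α ∈ (Finset.univ.map i).powerset,
      MonoidAlgebra.of ℂ (Se N) (MulAut.conj g
        (MulAut.conj (aProd α) (SemidirectProduct.inr (blockCycles ρ i))))) :
    MonoidAlgebra.of ℂ (Se N) g * qElem N ρ = qElem N ρ * MonoidAlgebra.of ℂ (Se N) g := by
  nth_rw 2 [h]
  rw [qElem_eq, Finset.mul_sum, Finset.sum_mul]
  refine Finset.sum_congr rfl fun i _ => ?_
  rw [Finset.mul_sum, Finset.sum_mul]
  exact Finset.sum_congr rfl fun α _ => of_mul_of_conj _ _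

theorem commute_inr_qElem (ρ : List ℕ) (σ : Equiv.Perm (Fin N)) :
    MonoidAlgebra.of ℂ (Se N) (SemidirectProduct.inr σ) * qElem N ρ
      = qElem N ρ * MonoidAlgebra.of ℂ (Se N) (SemidirectProduct.inr σ) := by
  have h : qElem N ρ = ∑ i : Places ρ ↪ Fin N, ∑ α ∈ (Finset.univ.map i).powerset,
      MonoidAlgebra.of ℂ (Se N) (MulAut.conj (SemidirectProduct.inr σ : Se N)
        (MulAut.conj (aProd α) (SemidirectProduct.inr (blockCycles ρ i)))) := by
    -- Conjugation by `σ` sends the summand of `(i, α)` to that of `(σ ∘ i, σ(α))`; both sums are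
    -- reindexed accordingly.
    rw [qElem_eq, ← Equiv.sum_comp (Equiv.embeddingCongr (Equiv.refl (Places ρ)) σ)]
    refine Finset.sum_congr rfl fun i _ => ?_
    have hi : Equiv.embeddingCongr (Equiv.refl (Places ρ)) σ i = i.trans σ.toEmbedding := rfl
    have hS : Finset.univ.map (i.trans σ.toEmbedding)
        = (Finset.univ.map i).map σ.toEmbedding := (Finset.map_map _ _ _).symm
    rw [hi, hS]
    refine (Finset.sum_bij (fun α _ => α.map σ.toEmbedding) ?_ ?_ ?_ ?_).symm
    · intro α hα
      rw [Finset.mem_powerset] at hα ⊢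
      exact Finset.map_subset_map.2 hα
    · intro α _ β _ hαβ
      exact Finset.map_injective _ hαβ
    · intro β hβ
      rw [Finset.mem_powerset] at hβ
      obtain ⟨α, hα, rfl⟩ := Finset.subset_map_iff.1 hβ
      exact ⟨α, Finset.mem_powerset.2 hα, rfl⟩
    · intro α _
      have h1 := DFunLike.congr_fun (conj_inr_mul_conj_aProd σ α)
        (SemidirectProduct.inr (blockCycles ρ i) : Se N)
      rw [MulAut.mul_apply, MulAut.mul_apply] at h1
      rw [h1, MulAut.conj_apply (SemidirectProduct.inr σ : Se N), ← map_mul, ← map_inv, ← map_mul]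
      unfold blockCycles
      rw [viaFintypeEmbedding_conj, mul_inv_cancel_right]
  exact of_mul_qElem h

theorem commute_a_qElem (ρ : List ℕ) (p : Fin N) :
    MonoidAlgebra.of ℂ (Se N) (SemidirectProduct.inl (CliffGroup.a p)) * qElem N ρ
      = qElem N ρ * MonoidAlgebra.of ℂ (Se N) (SemidirectProduct.inl (CliffGroup.a p)) := by
  have h : qElem N ρ = ∑ i : Places ρ ↪ Fin N, ∑ α ∈ (Finset.univ.map i).powerset,
      MonoidAlgebra.of ℂ (Se N) (MulAut.conj (SemidirectProduct.inl (CliffGroup.a p) : Se N)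
        (MulAut.conj (aProd α) (SemidirectProduct.inr (blockCycles ρ i)))) := by
    rw [qElem_eq]
    refine Finset.sum_congr rfl fun i _ => ?_
    by_cases hp : p ∈ Finset.univ.map i
    -- For `p` among the `i_t`, the subsets are split by whether they contain `p`. Conjugation by
    -- `a_p` interchanges the two halves, because it squares to the identity.
    · rw [← Finset.insert_erase hp, Finset.sum_powerset_insert (Finset.notMem_erase _ _),
        Finset.sum_powerset_insert (Finset.notMem_erase _ _), add_comm]
      congr 1 <;> refine Finset.sum_congr rfl fun α hα => ?_
      · rw [map_aProd_insert _ commute_conj_a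
          fun h => Finset.notMem_erase p _ (Finset.mem_powerset.1 hα h), MulAut.mul_apply]
      · rw [map_aProd_insert _ commute_conj_a
          fun h => Finset.notMem_erase p _ (Finset.mem_powerset.1 hα h), ← MulAut.mul_apply,
          ← mul_assoc, conj_a_mul_self, one_mul]
    -- For `p` outside the sequence, the cycles fix `p` and hence commute with `a_p`, while
    -- conjugation by `a_p` commutes with conjugation by `a_α`: each summand is fixed.
    · refine Finset.sum_congr rfl fun α hα => ?_
      have hpα : p ∉ α := fun h => hp (Finset.mem_powerset.1 hα h)
      have hτ : blockCycles ρ i p = p :=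
        Equiv.Perm.viaFintypeEmbedding_apply_notMem_range _ _ (by simpa using hp)
      have h1 : MulAut.conj (SemidirectProduct.inl (CliffGroup.a p) : Se N)
          (SemidirectProduct.inr (blockCycles ρ i)) = SemidirectProduct.inr (blockCycles ρ i) := by
        rw [MulAut.conj_apply, mul_inv_eq_iff_eq_mul, inr_mul_inl_a, hτ]
      have h2 : Commute (MulAut.conj (SemidirectProduct.inl (CliffGroup.a p) : Se N))
          (MulAut.conj (aProd α)) := by
        rw [map_aProd]
        refine Commute.list_prod_right _ _ fun x hx => ?_
        obtain ⟨q, _, rfl⟩ := List.mem_map.1 hx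
        exact commute_conj_a p q
      rw [← MulAut.mul_apply, h2.eq, MulAut.mul_apply, h1]
  exact of_mul_qElem h

/-- The elements `q_{ρ,N}` are central. -/
theorem qElem_mem_center (N : ℕ) (ρ : List ℕ) :
    qElem N ρ ∈ Subalgebra.center ℂ (MonoidAlgebra ℂ (Se N)) := by
  have key (g : Se N) : Commute (MonoidAlgebra.of ℂ (Se N) g) (qElem N ρ) := by
    have hinl (h : CliffGroup N) :
        Commute (MonoidAlgebra.of ℂ (Se N) (SemidirectProduct.inl h)) (qElem N ρ) := by
      have hh : h ∈ Subgroup.closure (Set.range (PresentedGroup.of (rels := cliffRels N))) := by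
        rw [PresentedGroup.closure_range_of]; exact Subgroup.mem_top h
      induction hh using Subgroup.closure_induction with
      | mem x hx =>
        obtain ⟨y, rfl⟩ := hx
        rcases y with _ | p
        · change Commute (MonoidAlgebra.of ℂ (Se N) (SemidirectProduct.inl (CliffGroup.eps N))) _
          exact of_mul_qElem (by rw [conj_eps]; exact qElem_eq ρ)
        · exact commute_a_qElem ρ p
      | one => rw [map_one, map_one]; exact Commute.one_left _
      | mul x y _ _ hx hy => rw [map_mul, map_mul]; exact hx.mul_left hy
      | inv x _ hx =>
        rw [map_inv]
        rw [commute_iff_eq] at hx ⊢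
        have h1 : MonoidAlgebra.of ℂ (Se N) (SemidirectProduct.inl x)⁻¹
            * MonoidAlgebra.of ℂ (Se N) (SemidirectProduct.inl x) = 1 := by
          rw [← map_mul, inv_mul_cancel, map_one]
        have h2 : MonoidAlgebra.of ℂ (Se N) (SemidirectProduct.inl x)
            * MonoidAlgebra.of ℂ (Se N) (SemidirectProduct.inl x)⁻¹ = 1 := by
          rw [← map_mul, mul_inv_cancel, map_one]
        calc _ = MonoidAlgebra.of ℂ (Se N) (SemidirectProduct.inl x)⁻¹ * (qElem N ρ
              * MonoidAlgebra.of ℂ (Se N) (SemidirectProduct.inl x))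
              * MonoidAlgebra.of ℂ (Se N) (SemidirectProduct.inl x)⁻¹ := by
                rw [← mul_assoc, mul_assoc _ _ (MonoidAlgebra.of ℂ (Se N)
                  (SemidirectProduct.inl x)⁻¹), h2, mul_one]
          _ = _ := by rw [← hx, ← mul_assoc, h1, one_mul]
    rw [← SemidirectProduct.inl_left_mul_inr_right g, map_mul]
    exact (hinl _).mul_left (commute_inr_qElem ρ _)
  rw [Subalgebra.mem_center_iff]
  intro b
  induction b using MonoidAlgebra.induction_on with
  | of g => exact key g
  | add x y hx hy => rw [add_mul, mul_add, hx, hy]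
  | smul r x hx => rw [smul_mul_assoc, mul_smul_comm, hx]

end SergeevGroup


/-! ### The operator of a special symmetrization. -/

section SymmetrizationAction

variable {n N : ℕ}

/-- Multiplying a product of operators in distinct places by an operator in one of them. -/
theorem ofFn_slot_mul_slot {k : ℕ} (p : Fin k → ZMod 2) (Y : Fin k → Q n)
    (hY : ∀ r, Y r ∈ Qgr n (p r)) {d : ZMod 2} {X : Q n} (hX : X ∈ Qgr n d)
    (s : Fin k → Fin N) (hs : Function.Injective s) (r : Fin k) :
    (List.ofFn fun v => slot (p v) (s v) (vecRep n (Y v))).prod * slot d (s r) (vecRep n X)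
      = (∏ v ∈ Finset.Ioi r, koszul (p v) d) • (List.ofFn fun v =>
          slot (Function.update p r (p r + d) v) (s v)
            (vecRep n (Function.update Y r (Y r * X) v))).prod := by
  induction k with
  | zero => exact r.elim0
  | succ k ih =>
    have hIoi (m : ℕ) (f : Fin m → ℂ) (r : Fin m) :
        ∏ s ∈ Finset.Ioi r, f s = ∏ s, if r < s then f s else 1 := by
      rw [← Finset.prod_filter]; congr 1; ext s; simp
    simp only [hIoi] at ih ⊢
    simp only [List.ofFn_succ', List.concat_eq_append, List.prod_append, List.prod_singleton,
      Fin.prod_univ_castSucc]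
    induction r using Fin.lastCases with
    | last =>
      have h1 (v : Fin k) : v.castSucc ≠ Fin.last k := (Fin.castSucc_lt_last v).ne
      have h2 (v : Fin k) : ¬ Fin.last k < v.castSucc := not_lt.2 (Fin.le_last _)
      simp only [Function.update_self, Function.update_of_ne (h1 _), h2, lt_irrefl, if_false,
        Finset.prod_const_one, mul_one, one_smul]
      rw [mul_assoc, slot_mul_same, map_mul (vecRep n)]
    | cast r =>
      have h1 : Fin.last k ≠ r.castSucc := (Fin.castSucc_lt_last r).ne'
      have h2 {α : Type} (f : Fin (k + 1) → α) (x : α) (v : Fin k) :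
          Function.update f r.castSucc x v.castSucc
            = Function.update (fun v : Fin k => f v.castSucc) r x v := by
        simp [Function.update_apply]
      simp only [Function.update_of_ne h1, h2, Fin.castSucc_lt_castSucc_iff, Fin.castSucc_lt_last,
        if_true]
      -- The last factor sits in another place, so `X` moves past it at the cost of one Koszul sign,
      -- and the induction hypothesis handles the shorter product.
      rw [mul_assoc, slot_comm (fun e => h1 (hs e)) (hasParity_vecRep (hY _))
        (hasParity_vecRep hX), mul_smul_comm, ← mul_assoc,
        ih (fun v => p v.castSucc) (fun v => Y v.castSucc) (fun v => hY _)
          (fun v => s v.castSucc) (fun a b h => Fin.castSucc_injective _ (hs h)) r,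
        smul_mul_assoc, smul_smul, mul_comm (koszul _ _)]

/-- Embeddings have no convenient splitting into an initial segment and a last value. Arbitrary
functions do, so injectivity is moved into an indicator. -/
theorem sum_embedding {k : ℕ} {M : Type*} [AddCommMonoid M] (g : (Fin k → Fin N) → M) :
    ∑ s : Fin k ↪ Fin N, g s
      = ∑ s : Fin k → Fin N, if Function.Injective s then g s else 0 := by
  rw [← Finset.sum_filter, ← Equiv.sum_comp (Equiv.subtypeInjectiveEquivEmbedding _ _)]
  exact (Finset.sum_subtype _ (by simp) g).symm

/-- The element `σ(Y₁ ⋯ Y_k)` acts by the sum over all sequences of `k` distinct places of the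
operators `Y₁, …, Y_k` in these places. -/
theorem gammaRep_specialSymm_ofFn (N : ℕ) {k : ℕ} (p : Fin k → ZMod 2) (Y : Fin k → Q n)
    (hY : ∀ r, Y r ∈ Qgr n (p r)) :
    gammaRep n N (specialSymm (Qgr n) (List.ofFn fun r => Env.ι (Qgr n) 0 (Y r)).prod)
      = ∑ s : Fin k ↪ Fin N,
          (List.ofFn fun r => slot (p r) (s r) (vecRep n (Y r))).prod := by
  induction k with
  | zero =>
    have h : specialSymm (Qgr n) 1 = 1 := by
      rw [specialSymm, LinearEquiv.symm_apply_eq, sigmaTilde_one]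
    simp [h]
  | succ k ih =>
    have hX := hY (Fin.last k)
    have hY' : ∀ r : Fin k, Y r.castSucc ∈ Qgr n (p r.castSucc) := fun r => hY _
    -- Right `*`-multiplication becomes right multiplication in the enveloping algebra, hence
    -- composition with the action of the last generator.
    have hstar (u : SuperSym (Qgr n)) : gammaRep n N (specialSymm (Qgr n)
          (Env.starOp 0 1 (Y (Fin.last k)) u))
        = gammaRep n N (specialSymm (Qgr n) u) * lieAct n N (Y (Fin.last k)) := by
      have h1 := sigmaTilde_mul_ι (Qgr n) (specialSymm (Qgr n) u) (Y (Fin.last k))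
      have h2 : sigmaTilde (Qgr n) (specialSymm (Qgr n) u) = u :=
        LinearEquiv.apply_symm_apply _ _
      rw [h2] at h1
      rw [← h1, specialSymm, LinearEquiv.symm_apply_apply, map_mul]
      congr 1
      exact Env.lift_ι _ _ _ _
    have hprod := starOp_prod (Qgr n) hX k (fun r => p r.castSucc) (fun r => Y r.castSucc) hY'
    have hupd (r v : Fin k) : Function.update (fun r : Fin k => Y r.castSucc) r
          (Y r.castSucc * Y (Fin.last k)) v
        ∈ Qgr n (Function.update (fun r : Fin k => p r.castSucc) r
          (p r.castSucc + p (Fin.last k)) v) := by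
      by_cases h : v = r
      · subst h
        simpa using SetLike.mul_mem_graded (hY' v) hX
      · simpa [h] using hY' v
    -- The explicit formula for `*` is solved for the plain product: it is the `*`-product minus the
    -- corrections. Both involve products of only `k` generators, so the induction hypothesis
    -- applies to each.
    rw [List.ofFn_succ', List.concat_eq_append, List.prod_append, List.prod_singleton,
      ← add_sub_cancel_right (_ * _) (∑ r, (∏ s ∈ Finset.Ioi r, koszul (p s.castSucc)
        (p (Fin.last k))) • (List.ofFn fun s => Env.ι (Qgr n) 0 (Function.update
          (fun r : Fin k => Y r.castSucc) r (Y r.castSucc * Y (Fin.last k)) s)).prod),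
      ← hprod, map_sub, map_sub, hstar, ih _ _ hY', map_sum, map_sum, sub_eq_iff_eq_add]
    simp only [map_smul, ih _ _ (hupd _)]
    -- A sequence of `k + 1` places is separated into its first `k` places and the last one, so that
    -- the identity can be checked for each fixed initial sequence `s`.
    rw [lieAct_hom hX, sum_embedding fun s => (List.ofFn fun r : Fin k =>
        slot (p r.castSucc) (s r) (vecRep n (Y r.castSucc))).prod,
      sum_embedding fun s => (List.ofFn fun r => slot (p r) (s r) (vecRep n (Y r))).prod,
      Finset.sum_mul, ← Equiv.sum_comp (Fin.snocEquiv fun _ => Fin N), Fintype.sum_prod_type,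
      Finset.sum_comm]
    simp only [Finset.smul_sum]
    rw [Finset.sum_comm (s := Finset.univ (α := Fin k)),
      sum_embedding fun s => ∑ r, (∏ v ∈ Finset.Ioi r, koszul (p v.castSucc)
        (p (Fin.last k))) • (List.ofFn fun v => slot (Function.update (fun r : Fin k =>
          p r.castSucc) r (p r.castSucc + p (Fin.last k)) v) (s v) (vecRep n (Function.update
            (fun r : Fin k => Y r.castSucc) r (Y r.castSucc * Y (Fin.last k)) v))).prod,
      ← Finset.sum_add_distrib]
    refine Finset.sum_congr rfl fun s _ => ?_
    have hsnoc (u : Fin N) : (Fin.snocEquiv fun _ => Fin N) (u, s)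
        = Fin.snoc (α := fun _ => Fin N) s u := rfl
    simp only [hsnoc, Fin.snoc_injective_iff]
    by_cases hs : Function.Injective s
    · simp only [hs, true_and, if_true, List.ofFn_succ', List.concat_eq_append, List.prod_append,
        List.prod_singleton, Fin.snoc_castSucc, Fin.snoc_last]
      simp only [← ofFn_slot_mul_slot (fun r : Fin k => p r.castSucc) (fun r => Y r.castSucc) hY'
        hX s hs]
      -- The place `u` of the new generator is either outside `s`, giving an injective sequence of
      -- length `k + 1`, or equal to a unique `s r`, giving the correction term at `r`.
      rw [Finset.mul_sum, ← Finset.sum_filter, ← Finset.sum_filter_add_sum_filter_not _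
        (fun u => u ∉ Set.range s)]
      congr 1
      rw [← Finset.sum_image (g := s) (f := fun u => (List.ofFn fun r : Fin k =>
        slot (p r.castSucc) (s r) (vecRep n (Y r.castSucc))).prod
          * slot (p (Fin.last k)) u (vecRep n (Y (Fin.last k)))) (fun a _ b _ h => hs h)]
      refine Finset.sum_congr ?_ fun _ _ => rfl
      ext u
      simp
    · simp [hs]

/-- The same, for factors labelled by a finite type enumerated by a list. -/
theorem gammaRep_specialSymm_list (N : ℕ) {κ : Type*} [Fintype κ] {l : List κ}
    (hl : l.Nodup) (hmem : ∀ x, x ∈ l) (p : κ → ZMod 2) (Y : κ → Q n)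
    (hY : ∀ x, Y x ∈ Qgr n (p x)) :
    gammaRep n N (specialSymm (Qgr n) (l.map fun x => Env.ι (Qgr n) 0 (Y x)).prod)
      = ∑ s : κ ↪ Fin N, (l.map fun x => slot (p x) (s x) (vecRep n (Y x))).prod := by
  classical
  have h := gammaRep_specialSymm_ofFn N (fun r => p (l.get r)) (fun r => Y (l.get r))
    (fun r => hY _)
  have hmap {β : Type _} (f : κ → β) : l.map f = List.ofFn fun r => f (l.get r) := by
    conv_lhs => rw [← List.ofFn_get l, List.map_ofFn]
    rfl
  rw [hmap, h, ← Equiv.sum_comp (Equiv.embeddingCongr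
    (List.Nodup.getEquivOfForallMemList l hl hmem) (Equiv.refl (Fin N)))]
  refine Finset.sum_congr rfl fun s _ => ?_
  rw [hmap]
  congr 2
  funext r
  have : (Equiv.embeddingCongr (List.Nodup.getEquivOfForallMemList l hl hmem)
      (Equiv.refl (Fin N)) s) (l.get r) = s ((List.Nodup.getEquivOfForallMemList l hl hmem).symm
        (List.Nodup.getEquivOfForallMemList l hl hmem r)) := rfl
  rw [this, Equiv.symm_apply_apply]

end SymmetrizationAction


/-! ### The operator of a cycle. -/

section CycleOperators

variable {n N : ℕ}

/-- Expanding a noncommutative product of sums. -/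
theorem prod_sum_finRange {R : Type*} [Semiring R] : ∀ (m : ℕ) (α : Fin m → Type)
    [∀ j, Fintype (α j)] (f : ∀ j, α j → R),
    ((List.finRange m).map fun j => ∑ x, f j x).prod
      = ∑ x : ∀ j, α j, ((List.finRange m).map fun j => f j (x j)).prod
  | 0, α, _, f => by simp
  | m + 1, α, _, f => by
    rw [← Equiv.sum_comp (Fin.consEquiv α), Fintype.sum_prod_type]
    simp only [List.finRange_succ, List.map_cons, List.prod_cons, List.map_map]
    have h := prod_sum_finRange m (fun j => α j.succ) (fun j => f j.succ)
    simp only [Function.comp_def]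
    rw [h, Finset.sum_mul_sum]
    rfl

theorem prod_smul_list {R ι : Type*} [Ring R] [Algebra ℂ R] (l : List ι) (c : ι → ℂ) (f : ι → R) :
    (l.map fun x => c x • f x).prod = (l.map c).prod • (l.map f).prod := by
  induction l with
  | nil => simp
  | cons x l ih => rw [List.map_cons, List.prod_cons, ih, smul_mul_smul_comm]; simp

/-- This is `(s₁, …, s_m) = (s₁, …, s_{m-1}) (s_{m-1}, s_m)`, with the right factor applied first.
It lets a cycle be built one transposition at a time. -/
theorem viaFintypeEmbedding_finRotate_succ {k : ℕ} (s : Fin (k + 2) ↪ Fin N) :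
    (finRotate (k + 2)).viaFintypeEmbedding s
      = (finRotate (k + 1)).viaFintypeEmbedding (Fin.castSuccEmb.trans s)
        * Equiv.swap (s (Fin.last k).castSucc) (s (Fin.last (k + 1))) := by
  set s' := Fin.castSuccEmb.trans s with hs'
  have hs (v : Fin (k + 1)) : s' v = s v.castSucc := rfl
  have hlast : s (Fin.last (k + 1)) ∉ Set.range s' := by
    rintro ⟨v, hv⟩
    exact (Fin.castSucc_lt_last v).ne (s.injective hv)
  ext1 x
  rw [Equiv.Perm.mul_apply]
  by_cases h : x ∈ Set.range s
  · obtain ⟨y, rfl⟩ := h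
    rw [Equiv.Perm.viaFintypeEmbedding_apply_image]
    induction y using Fin.lastCases with
    | last =>
      rw [Equiv.swap_apply_right, ← hs, Equiv.Perm.viaFintypeEmbedding_apply_image, hs,
        finRotate_last, finRotate_last]
      rfl
    | cast y =>
      induction y using Fin.lastCases with
      | last =>
        rw [Equiv.swap_apply_left, Equiv.Perm.viaFintypeEmbedding_apply_notMem_range _ _ hlast]
        congr 1
        rw [finRotate_apply]
        simp
      | cast y =>
        rw [Equiv.swap_apply_of_ne_of_ne, ← hs, Equiv.Perm.viaFintypeEmbedding_apply_image, hs]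
        · congr 1
          rw [finRotate_apply, finRotate_apply]
          simp
        · exact fun e => (Fin.castSucc_lt_last y).ne
            (Fin.castSucc_injective _ (s.injective e))
        · exact fun e => (Fin.castSucc_lt_last y.castSucc).ne (s.injective e)
  · have h1 : x ∉ Set.range s' := by
      rintro ⟨v, rfl⟩
      exact h ⟨_, rfl⟩
    rw [Equiv.swap_apply_of_ne_of_ne (fun e => h ⟨_, e.symm⟩) (fun e => h ⟨_, e.symm⟩),
      Equiv.Perm.viaFintypeEmbedding_apply_notMem_range _ _ h,
      Equiv.Perm.viaFintypeEmbedding_apply_notMem_range _ _ h1]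

/-- The sign `(-1)^{p(i₂) + ⋯ + p(i_k)}`. -/
def cycleSign {k : ℕ} (i : Fin k → Idx n) : ℂ :=
  ∏ t : Fin k, if (t : ℕ) = 0 then 1 else (-1 : ℂ) ^ (par (i t)).val

/-- A cycle acts as `∑ (-1)^{p(i₂) + ⋯ + p(i_k)} E_{i₁i₂} ⊗ E_{i₂i₃} ⊗ ⋯ ⊗ E_{i_ki₁}`, placed along
the cycle. -/
theorem permRep_cycle (n : ℕ) : ∀ {k : ℕ} (s : Fin k ↪ Fin N),
    permRep n N ((finRotate k).viaFintypeEmbedding s)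
      = ∑ i : Fin k → Idx n, cycleSign i • (List.ofFn fun t =>
          slot (par (i t) + par (i (finRotate k t))) (s t)
            (unitOp (i t) (i (finRotate k t)))).prod
  | 0, s => by
    have : (finRotate 0).viaFintypeEmbedding s = 1 := by
      ext1 x
      rw [Equiv.Perm.viaFintypeEmbedding_apply_notMem_range]
      · rfl
      · rintro ⟨v, _⟩
        exact v.elim0
    rw [this]
    simp [cycleSign]
  | 1, s => by
    have : (finRotate 1).viaFintypeEmbedding s = 1 := by
      ext1 x
      by_cases h : x ∈ Set.range s
      · obtain ⟨y, rfl⟩ := h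
        simp
      · rw [Equiv.Perm.viaFintypeEmbedding_apply_notMem_range _ _ h]
        rfl
    -- A cycle of length one is the identity, written as the sum of the even units `E_{aa}`; the
    -- sign is trivial since the first index does not enter it.
    rw [this, map_one, ← Equiv.sum_comp (Equiv.funUnique (Fin 1) (Idx n)).symm]
    have h2 (a : Idx n) : par a + par a = 0 := CharTwo.add_self_eq_zero _
    simp only [cycleSign, Equiv.funUnique_symm_apply, uniqueElim_const, List.ofFn_succ,
      List.ofFn_zero, List.prod_singleton, h2]
    simp only [Finset.univ_unique, Finset.prod_singleton, Fin.default_eq_zero, Fin.val_zero, if_true,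
      one_smul]
    rw [← map_sum, sum_unitOp_self, slot_zero_one]
  | k + 2, s => by
    have hne : s (Fin.last k).castSucc ≠ s (Fin.last (k + 1)) :=
      fun e => (Fin.castSucc_lt_last _).ne (s.injective e)
    rw [viaFintypeEmbedding_finRotate_succ, map_mul, permRep_cycle n, permRep_swap hne,
      ← Equiv.sum_comp (Fin.snocEquiv fun _ : Fin (k + 2) => Idx n), Fintype.sum_prod_type_right,
      Finset.sum_mul]
    refine Finset.sum_congr rfl fun i _ => ?_
    have hrot1 (v : Fin k) : finRotate (k + 2) v.castSucc.castSucc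
        = (finRotate (k + 1) v.castSucc).castSucc := by
      rw [finRotate_apply, finRotate_apply]
      simp
    have hrot2 : finRotate (k + 2) (Fin.last k).castSucc = Fin.last (k + 1) := by
      rw [finRotate_apply]
      simp
    have hrot3 : finRotate (k + 2) (Fin.last (k + 1)) = (0 : Fin (k + 1)).castSucc :=
      finRotate_last
    have hrot4 : finRotate (k + 1) (Fin.last k) = 0 := finRotate_last
    have hsnoc (b : Idx n) : (Fin.snocEquiv fun _ => Idx n) (b, i)
        = Fin.snoc (α := fun _ => Idx n) i b := rfl
    have hsign (b : Idx n) : cycleSign (Fin.snoc (α := fun _ => Idx n) i b)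
        = cycleSign i * (-1) ^ (par b).val := by
      rw [cycleSign, Fin.prod_univ_castSucc]
      simp [cycleSign]
    rw [Finset.mul_sum]
    -- At the old last place the cycle has a unit with column index `i 0`, and the transposition
    -- contributes `E_{ab}` there. The product vanishes unless `a = i 0`; then it ends in `b`, the
    -- new place receives the unit from `b` to `i 0`, and `(-1)^{p(b)}` is the sign of the appended
    -- index.
    rw [Finset.sum_eq_single (i 0)]
    · rw [Finset.mul_sum]
      refine Finset.sum_congr rfl fun b _ => ?_
      rw [hsnoc, hsign, smul_mul_smul_comm]
      congr 1
      simp only [List.ofFn_succ', List.concat_eq_append, List.prod_append, List.prod_singleton,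
        hrot1, hrot2, hrot3, hrot4, Fin.snoc_castSucc, Fin.snoc_last]
      have hp : par (i (Fin.last k)) + par (i 0) + (par (i 0) + par b)
          = par (i (Fin.last k)) + par b := by
        rw [add_assoc, ← add_assoc (par (i 0)), CharTwo.add_self_eq_zero, zero_add]
      rw [← mul_assoc, mul_assoc (List.prod _)]
      simp only [Function.Embedding.trans_apply, Fin.coe_castSuccEmb]
      rw [slot_mul_same, unitOp_mul, if_pos rfl, hp]
    · intro a _ ha
      rw [Finset.mul_sum]
      refine Finset.sum_eq_zero fun b _ => ?_
      rw [smul_mul_smul_comm]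
      simp only [List.ofFn_succ', List.concat_eq_append, List.prod_append, List.prod_singleton,
        hrot4]
      rw [← mul_assoc, mul_assoc (List.prod _)]
      simp only [Function.Embedding.trans_apply, Fin.coe_castSuccEmb]
      rw [slot_mul_same, unitOp_mul, if_neg ha.symm, map_zero, mul_zero, zero_mul, smul_zero]
    · simp

end CycleOperators


/-! ### Conjugating products of one-place operators by the Clifford generators. -/

section Conjugation

variable {n N : ℕ} {κ : Type*}

/-- Conjugation of operators on the tensor space by elements of `Se(N)`. -/
def conjRep (n N : ℕ) : Se N →* Module.End ℂ (Module.End ℂ (Tens n N)) where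
  toFun g := LinearMap.mulLeft ℂ (sergeevRep n N g) ∘ₗ LinearMap.mulRight ℂ (sergeevRep n N g⁻¹)
  map_one' := by
    ext1 Z
    simp
  map_mul' g h := by
    ext1 Z
    simp [mul_assoc]

theorem conjRep_apply (g : Se N) (Z : Module.End ℂ (Tens n N)) :
    conjRep n N g Z = sergeevRep n N g * (Z * sergeevRep n N g⁻¹) := rfl

theorem sergeevRep_inl_eps :
    sergeevRep n N (SemidirectProduct.inl (CliffGroup.eps N)) = (-1 : ℂ) • 1 := by
  simp only [sergeevRep, MonoidHom.comp_apply, SemidirectProduct.lift_inl, cliffRep,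
    CliffGroup.lift_eps]
  rfl

theorem sergeevRep_inl_a (t : Fin N) :
    sergeevRep n N (SemidirectProduct.inl (CliffGroup.a t)) = cliffOp n t := by
  simp only [sergeevRep, MonoidHom.comp_apply, SemidirectProduct.lift_inl, cliffRep,
    CliffGroup.lift_a]
  rfl

theorem sergeevRep_inr (τ : Equiv.Perm (Fin N)) :
    sergeevRep n N (SemidirectProduct.inr τ) = permRep n N τ := by
  simp only [sergeevRep, MonoidHom.comp_apply, SemidirectProduct.lift_inr]
  rfl

theorem conjRep_eps : conjRep n N (SemidirectProduct.inl (CliffGroup.eps N)) = 1 := by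
  have h : (SemidirectProduct.inl (CliffGroup.eps N) : Se N)⁻¹
      = SemidirectProduct.inl (CliffGroup.eps N) := by
    rw [inv_eq_iff_mul_eq_one, ← map_mul, ← pow_two, CliffGroup.eps_sq, map_one]
  ext1 Z
  rw [conjRep_apply, h, sergeevRep_inl_eps]
  simp [smul_smul]

/-- The operators `cliffOp` anticommute in distinct places, but the sign cancels in conjugation;
this makes `map_aProd_insert` applicable to `conjRep`. -/
theorem commute_conjRep_a (p q : Fin N) :
    Commute (conjRep n N (SemidirectProduct.inl (CliffGroup.a p)))
      (conjRep n N (SemidirectProduct.inl (CliffGroup.a q))) := by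
  by_cases h : p = q
  · subst h; exact Commute.refl _
  · rw [commute_iff_eq, ← map_mul, ← map_mul, CliffGroup.a_mul_a h, mul_assoc, map_mul, map_mul,
      conjRep_eps, one_mul, map_mul, map_mul]

theorem conjRep_a_of_eq {t : Fin N} {Z Z' : Module.End ℂ (Tens n N)}
    (h : cliffOp n t * Z = Z' * cliffOp n t) :
    conjRep n N (SemidirectProduct.inl (CliffGroup.a t)) Z = Z' := by
  rw [conjRep_apply, ← mul_assoc, sergeevRep_inl_a, h, ← sergeevRep_inl_a, mul_assoc, ← map_mul,
    mul_inv_cancel, map_one, mul_one]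

theorem cliffOp_mul_prod_slot_of_ne (l : List κ) (p : κ → ZMod 2) (s : κ → Fin N)
    (M : κ → Module.End ℂ (Idx n → ℂ)) (hM : ∀ x, HasParity (p x) (M x)) {u : Fin N}
    (hu : ∀ x ∈ l, s x ≠ u) :
    cliffOp n u * (l.map fun x => slot (p x) (s x) (M x)).prod
      = (l.map fun x => koszul 1 (p x)).prod •
        ((l.map fun x => slot (p x) (s x) (M x)).prod * cliffOp n u) := by
  induction l with
  | nil => simp
  | cons x l ih =>
    have h1 := ih fun y hy => hu y (List.mem_cons_of_mem _ hy)
    have h2 : cliffOp n u * slot (p x) (s x) (M x)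
        = koszul 1 (p x) • (slot (p x) (s x) (M x) * cliffOp n u) :=
      slot_comm (hu x List.mem_cons_self).symm (hasParity_P n) (hM x)
    simp only [List.map_cons, List.prod_cons]
    rw [← mul_assoc, h2, smul_mul_assoc, mul_assoc, h1, mul_smul_comm, smul_smul, mul_assoc]

/-- Each factor contributes its Koszul sign: those in other places by the rule of signs, the one in
the place of the Clifford operator by `hX`. The total sign is thus governed by the parity of the
whole product and does not depend on `t`. -/
theorem cliffOp_mul_prod_slot [DecidableEq κ] {l : List κ} (hl : l.Nodup)
    (p : κ → ZMod 2) (s : κ ↪ Fin N)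
    (M : κ → Module.End ℂ (Idx n → ℂ)) (hM : ∀ x, HasParity (p x) (M x)) {t : κ} (ht : t ∈ l)
    {X : Module.End ℂ (Idx n → ℂ)} (hX : P n * M t = koszul 1 (p t) • (X * P n)) :
    cliffOp n (s t) * (l.map fun x => slot (p x) (s x) (M x)).prod
      = (l.map fun x => koszul 1 (p x)).prod •
        ((l.map fun x => slot (p x) (s x) (Function.update M t X x)).prod
          * cliffOp n (s t)) := by
  induction l with
  | nil => simp at ht
  | cons x l ih =>
    rw [List.nodup_cons] at hl
    simp only [List.map_cons, List.prod_cons]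
    by_cases h : x = t
    · subst h
      have h1 := cliffOp_mul_prod_slot_of_ne l p s M hM (u := s x)
        fun y hy e => hl.1 (s.injective e ▸ hy)
      have h2 : cliffOp n (s x) * slot (p x) (s x) (M x)
          = koszul 1 (p x) • (slot (p x) (s x) X * cliffOp n (s x)) := by
        rw [cliffOp, slot_mul_same, hX, map_smul, slot_mul_same, add_comm]
      have h3 : (l.map fun y => slot (n := n) (p y) (s y) (Function.update M x X y))
          = l.map fun y => slot (p y) (s y) (M y) :=
        List.map_congr_left fun y hy => by
          rw [Function.update_of_ne (ne_of_mem_of_not_mem hy hl.1)]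
      rw [h3, Function.update_self, ← mul_assoc, h2, smul_mul_assoc, mul_assoc, h1,
        mul_smul_comm, smul_smul, mul_assoc]
    · have ht' : t ∈ l := (List.mem_cons.1 ht).resolve_left (Ne.symm h)
      have h2 : cliffOp n (s t) * slot (p x) (s x) (M x)
          = koszul 1 (p x) • (slot (p x) (s x) (M x) * cliffOp n (s t)) :=
        slot_comm (fun e => h (s.injective e).symm) (hasParity_P n) (hM x)
      rw [Function.update_of_ne h, ← mul_assoc, h2, smul_mul_assoc, mul_assoc, ih hl.2 ht',
        mul_smul_comm, smul_smul, mul_assoc]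

theorem prod_map_add_update [DecidableEq κ] {R : Type*} [Semiring R] {l : List κ}
    (hl : l.Nodup) {t : κ} (ht : t ∈ l) (f : κ → R) (r : R) :
    (l.map f).prod + (l.map (Function.update f t r)).prod
      = (l.map (Function.update f t (f t + r))).prod := by
  induction l with
  | nil => simp at ht
  | cons x l ih =>
    rw [List.nodup_cons] at hl
    simp only [List.map_cons, List.prod_cons]
    by_cases h : x = t
    · subst h
      have h3 (r : R) : l.map (Function.update f x r) = l.map f :=
        List.map_congr_left fun y hy => by
          rw [Function.update_of_ne (ne_of_mem_of_not_mem hy hl.1)]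
      rw [h3, h3, Function.update_self, Function.update_self, add_mul]
    · have ht' : t ∈ l := (List.mem_cons.1 ht).resolve_left (Ne.symm h)
      rw [Function.update_of_ne h, Function.update_of_ne h, ← mul_add, ih hl.2 ht']

/-- Summing the conjugates of an even product of operators in distinct places by the elements
`a_α`, for all sets `α` of places labelled by `S`. -/
theorem sum_conjRep_prod_slot [DecidableEq κ] {l : List κ} (hl : l.Nodup)
    (p : κ → ZMod 2) (s : κ ↪ Fin N)
    (M M' : κ → Module.End ℂ (Idx n → ℂ)) (hM : ∀ x, HasParity (p x) (M x))
    (hM' : ∀ x, HasParity (p x) (M' x))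
    (hP : ∀ x, P n * M x = koszul 1 (p x) • (M' x * P n))
    (heven : (l.map fun x => koszul 1 (p x)).prod = 1) (S : Finset κ) (hS : ∀ x ∈ S, x ∈ l) :
    ∑ α ∈ (S.map s).powerset, conjRep n N (aProd α)
        (l.map fun x => slot (p x) (s x) (M x)).prod
      = (l.map fun x => slot (p x) (s x) (if x ∈ S then M x + M' x else M x)).prod := by
  induction S using Finset.induction_on with
  | empty =>
    have h : (aProd ∅ : Se N) = 1 := by simp [aProd]
    simp [h]
  | insert t S ht ih =>
    have ht' : s t ∉ S.map s := by simpa using ht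
    have htl := hS t (Finset.mem_insert_self _ _)
    -- The subsets containing `s t` contribute the conjugate by `a_{s t}` of the sum over those that
    -- do not.
    have h1 : ∑ α ∈ (S.map s).powerset, conjRep n N (aProd (insert (s t) α))
          (l.map fun x => slot (p x) (s x) (M x)).prod
        = conjRep n N (SemidirectProduct.inl (CliffGroup.a (s t)))
          (∑ α ∈ (S.map s).powerset, conjRep n N (aProd α)
            (l.map fun x => slot (p x) (s x) (M x)).prod) := by
      rw [map_sum]
      refine Finset.sum_congr rfl fun α hα => ?_
      rw [map_aProd_insert _ commute_conjRep_a fun h => ht' (Finset.mem_powerset.1 hα h)]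
      rfl
    rw [Finset.map_insert, Finset.sum_powerset_insert ht', h1,
      ih fun x hx => hS x (Finset.mem_insert_of_mem hx)]
    -- `L` lists the factors after the places of `S` have been summed out; at `t` it is still `M t`,
    -- so conjugation replaces just that factor by `M' t`.
    set L : κ → Module.End ℂ (Idx n → ℂ) := fun x => if x ∈ S then M x + M' x else M x with hL
    have hLt : L t = M t := if_neg ht
    have hLp : ∀ x, HasParity (p x) (L x) := by
      intro x
      simp only [hL]
      split_ifs
      · rw [HasParity, mul_add, hM x, hM' x, add_mul, smul_add]
      · exact hM x
    have h2 := cliffOp_mul_prod_slot hl p s L hLp htl (X := M' t) (by rw [hLt]; exact hP t)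
    -- Evenness removes the sign, so the two halves differ in one factor only and add up by
    -- linearity in it.
    rw [heven, one_smul] at h2
    have hupd (X : Module.End ℂ (Idx n → ℂ)) :
        (fun x => slot (n := n) (p x) (s x) (Function.update L t X x))
          = Function.update (fun x => slot (p x) (s x) (L x)) t (slot (p t) (s t) X) := by
      funext x
      by_cases h : x = t
      · subst h; simp
      · simp [h]
    rw [conjRep_a_of_eq h2, hupd, prod_map_add_update hl htl, ← map_add, ← hupd]
    congr 1
    refine List.map_congr_left fun x _ => ?_
    congr 1
    by_cases h : x = t
    · subst h; rw [Function.update_self, if_neg ht, if_pos (Finset.mem_insert_self _ _)]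
    · simp [h, hL]

end Conjugation

/-! ### Products of several cycles and the final comparison. -/

section Blocks

variable {n N : ℕ}

/-- The places of `Places ρ` in their order. -/
def placesList (ρ : List ℕ) : List (Places ρ) :=
  (List.finRange ρ.length).sigma fun j => List.finRange (ρ.get j)

theorem placesList_nodup (ρ : List ℕ) : (placesList ρ).Nodup :=
  (List.nodup_finRange _).sigma fun _ => List.nodup_finRange _

theorem mem_placesList {ρ : List ℕ} (x : Places ρ) : x ∈ placesList ρ := by
  obtain ⟨j, t⟩ := x
  exact List.mem_sigma.2 ⟨List.mem_finRange _, List.mem_finRange _⟩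

theorem prod_map_placesList {R : Type*} [Monoid R] (ρ : List ℕ) (f : Places ρ → R) :
    ((placesList ρ).map f).prod
      = ((List.finRange ρ.length).map fun j => (List.ofFn fun t => f ⟨j, t⟩).prod).prod := by
  rw [placesList, List.sigma, List.map_flatMap, List.flatMap, List.prod_flatten, List.map_map]
  congr 1
  refine List.map_congr_left fun j _ => ?_
  rw [Function.comp_apply, List.map_map, List.ofFn_eq_map]
  rfl

/-- The blocks occupy disjoint sets of places, so at `s ⟨j, t⟩` only the cycle of the block `j`
acts. The pointwise check `hlist` is made for any list of distinct blocks to allow induction. -/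
theorem blockCycles_eq_prod (ρ : List ℕ) (s : Places ρ ↪ Fin N) :
    blockCycles ρ s = ((List.finRange ρ.length).map fun j =>
      (finRotate (ρ.get j)).viaFintypeEmbedding
        ((Function.Embedding.sigmaMk j).trans s)).prod := by
  set c := fun j : Fin ρ.length => (finRotate (ρ.get j)).viaFintypeEmbedding
    ((Function.Embedding.sigmaMk j).trans s) with hc
  have hself (j : Fin ρ.length) (t : Fin (ρ.get j)) :
      c j (s ⟨j, t⟩) = s ⟨j, finRotate _ t⟩ :=
    Equiv.Perm.viaFintypeEmbedding_apply_image _ ((Function.Embedding.sigmaMk j).trans s) t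
  have hne {j j' : Fin ρ.length} (h : j ≠ j') (t : Fin (ρ.get j)) :
      c j' (s ⟨j, t⟩) = s ⟨j, t⟩ := by
    refine Equiv.Perm.viaFintypeEmbedding_apply_notMem_range _ _ ?_
    rintro ⟨t', e⟩
    exact h (congrArg Sigma.fst (s.injective e)).symm
  have hlist (L : List (Fin ρ.length)) (hL : L.Nodup) (j : Fin ρ.length) (t : Fin (ρ.get j)) :
      (L.map c).prod (s ⟨j, t⟩) = if j ∈ L then s ⟨j, finRotate _ t⟩ else s ⟨j, t⟩ := by
    induction L with
    | nil => simp
    | cons i L ih =>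
      rw [List.nodup_cons] at hL
      rw [List.map_cons, List.prod_cons, Equiv.Perm.mul_apply, ih hL.2]
      by_cases h : j = i
      · subst h
        rw [if_neg hL.1, hself, if_pos List.mem_cons_self]
      · split_ifs with h1 h2 h2
        · exact hne h _
        · exact absurd (List.mem_cons_of_mem _ h1) h2
        · exact absurd ((List.mem_cons.1 h2).resolve_left h) h1
        · exact hne h _
  ext1 x
  by_cases h : x ∈ Set.range s
  · obtain ⟨⟨j, t⟩, rfl⟩ := h
    rw [hlist _ (List.nodup_finRange _), if_pos (List.mem_finRange _), blockCycles,
      Equiv.Perm.viaFintypeEmbedding_apply_image]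
    rfl
  · rw [blockCycles, Equiv.Perm.viaFintypeEmbedding_apply_notMem_range _ _ h]
    have hfix (L : List (Fin ρ.length)) : (L.map c).prod x = x := by
      induction L with
      | nil => simp
      | cons i L ih =>
        rw [List.map_cons, List.prod_cons, Equiv.Perm.mul_apply, ih]
        refine Equiv.Perm.viaFintypeEmbedding_apply_notMem_range _ _ ?_
        rintro ⟨t, rfl⟩
        exact h ⟨_, rfl⟩
    exact (hfix _).symm

/-- The families of index sequences `(i₁, …, i_{ρ_j})`, one for each block. -/
abbrev BlockIdx (n : ℕ) (ρ : List ℕ) : Type := ∀ j : Fin ρ.length, Fin (ρ.get j) → Idx n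

/-- The product of the signs of the index sequences of the blocks. -/
def blockSign {ρ : List ℕ} (x : BlockIdx n ρ) : ℂ :=
  ((List.finRange ρ.length).map fun j => cycleSign (x j)).prod

/-- The index following the one at a given place, cyclically in its block. -/
def nextIdx {ρ : List ℕ} (x : BlockIdx n ρ) (y : Places ρ) : Idx n := x y.1 (finRotate _ y.2)

theorem JList_eq_sum (n : ℕ) (ρ : List ℕ) : JList n ρ = ∑ x : BlockIdx n ρ, blockSign x •
    ((placesList ρ).map fun y => Env.ι (Qgr n) 0 (F (x y.1 y.2) (nextIdx x y))).prod := by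
  have h : JList n ρ = ((List.finRange ρ.length).map fun j => J n (ρ.get j)).prod := by
    rw [JList]
    conv_lhs => rw [← List.ofFn_get ρ, List.map_ofFn, List.ofFn_eq_map]
    rfl
  rw [h]
  simp only [J]
  rw [prod_sum_finRange]
  refine Finset.sum_congr rfl fun x _ => ?_
  rw [prod_smul_list, prod_map_placesList]
  rfl

/-- The exact analogue of `JList_eq_sum`, with the same index families and signs and with matrix
units instead of the `F`; this permits a term-by-term comparison. -/
theorem permRep_blockCycles (n : ℕ) (ρ : List ℕ) (s : Places ρ ↪ Fin N) :
    permRep n N (blockCycles ρ s) = ∑ x : BlockIdx n ρ, blockSign x •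
      ((placesList ρ).map fun y => slot (par (x y.1 y.2) + par (nextIdx x y)) (s y)
        (unitOp (x y.1 y.2) (nextIdx x y))).prod := by
  rw [blockCycles_eq_prod, map_list_prod, List.map_map]
  simp only [Function.comp_def, permRep_cycle]
  rw [prod_sum_finRange]
  refine Finset.sum_congr rfl fun x _ => ?_
  refine (prod_smul_list (R := Module.End ℂ (Tens n N)) _ _ _).trans ?_
  rw [prod_map_placesList]
  rfl

/-- Each index occurs once as a row and once as a column within its block, because rotation is a
bijection, so its parity is counted twice. This supplies the evenness needed for
`sum_conjRep_prod_slot`. -/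
theorem prod_koszul_placesList {ρ : List ℕ} (x : BlockIdx n ρ) :
    ((placesList ρ).map fun y => koszul 1 (par (x y.1 y.2) + par (nextIdx x y))).prod = 1 := by
  rw [prod_map_placesList]
  refine List.prod_eq_one fun z hz => ?_
  obtain ⟨j, _, rfl⟩ := List.mem_map.1 hz
  simp only [nextIdx]
  rw [List.prod_ofFn]
  simp only [koszul_add_right]
  rw [Finset.prod_mul_distrib, Equiv.prod_comp (finRotate (ρ.get j)) fun t =>
    koszul 1 (par (x j t)), ← Finset.prod_mul_distrib]
  exact Finset.prod_eq_one fun t _ => koszul_sq _ _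

/-- The elements `q_{ρ,N}` and `σ(J_ρ)` act on the tensor space by the same operator. -/
theorem sergeevRep_qElem (n N : ℕ) (ρ : List ℕ) :
    (sergeevRep n N).asAlgebraHom (qElem N ρ)
      = gammaRep n N (specialSymm (Qgr n) (JList n ρ)) := by
  classical
  have hR : gammaRep n N (specialSymm (Qgr n) (JList n ρ))
      = ∑ s : Places ρ ↪ Fin N, ∑ x : BlockIdx n ρ, blockSign x •
        ((placesList ρ).map fun y => slot (par (x y.1 y.2) + par (nextIdx x y)) (s y)
          (vecRep n (F (x y.1 y.2) (nextIdx x y)))).prod := by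
    rw [JList_eq_sum, map_sum, map_sum, Finset.sum_comm]
    refine Finset.sum_congr rfl fun x _ => ?_
    rw [map_smul, map_smul, ← Finset.smul_sum]
    congr 1
    exact gammaRep_specialSymm_list N (placesList_nodup ρ) mem_placesList
      (fun y => par (x y.1 y.2) + par (nextIdx x y)) (fun y => F (x y.1 y.2) (nextIdx x y))
      fun y => F_mem_Qgr _ _
  rw [hR, qElem, map_sum]
  refine Finset.sum_congr rfl fun s _ => ?_
  have hconj (α : Finset (Fin N)) : (sergeevRep n N).asAlgebraHom (MonoidAlgebra.of ℂ (Se N)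
        (aProd α * SemidirectProduct.inr (blockCycles ρ s) * (aProd α)⁻¹))
      = conjRep n N (aProd α) (permRep n N (blockCycles ρ s)) := by
    rw [Representation.asAlgebraHom_of, conjRep_apply, map_mul, map_mul, sergeevRep_inr, mul_assoc]
  simp only [map_sum, hconj, permRep_blockCycles, map_smul]
  rw [Finset.sum_comm]
  refine Finset.sum_congr rfl fun x _ => ?_
  -- Taken with `M = E_{ij}`, `M' = E_{δ(i)δ(j)}` and all places in `S`; the reflected unit has the
  -- same parity because `δ` flips the parities of both indices. The resulting sums `M + M'` are the
  -- operators of `F_{ij}`.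
  rw [← Finset.smul_sum, sum_conjRep_prod_slot (placesList_nodup ρ)
    (fun y => par (x y.1 y.2) + par (nextIdx x y)) s
    (fun y => unitOp (x y.1 y.2) (nextIdx x y))
    (fun y => unitOp (x y.1 y.2).swap (nextIdx x y).swap) (fun y => hasParity_unitOp _ _)
    (fun y => by
      have h := hasParity_unitOp (x y.1 y.2).swap (nextIdx x y).swap
      rwa [par_swap, par_swap, add_add_add_comm, two_zmod2, add_zero] at h)
    (fun y => P_mul_unitOp _ _) (prod_koszul_placesList x) _ fun y _ => mem_placesList y]
  simp only [Finset.mem_univ, if_true, vecRep_F]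

end Blocks

end SuperDuality

end

theorem theorem2p5 (n N k : ℕ) (ρ : Nat.Partition k) (hk : k ≤ N) :
    SuperDuality.qElem N (SuperDuality.partsList ρ)
      ∈ Subalgebra.center ℂ (MonoidAlgebra ℂ (SuperDuality.Se N)) ∧
    (SuperDuality.sergeevRep n N).asAlgebraHom (SuperDuality.qElem N (SuperDuality.partsList ρ))
      = SuperDuality.gammaRep n N
          (SuperDuality.specialSymm (SuperDuality.Qgr n)
            (SuperDuality.JList n (SuperDuality.partsList ρ))) :=
  ⟨SuperDuality.qElem_mem_center N _, SuperDuality.sergeevRep_qElem n N _⟩
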